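/- Let $\theta>0$. For $\alpha,\beta>0$ with $\alpha\beta>1$ let $\delta>0$ be given by $\coth\delta=\alpha\beta$, put $\rho=e^{-\delta}$, $\gamma=\sqrt{\alpha/\beta}$, and let $\boldsymbol P_\delta^{(\gamma)}$ be the linear time-varying filter on $L^2(\mathbb R)$ $$(\boldsymbol P_\delta^{(\gamma)}f)(t)=e^{-\frac{t^2}{2\alpha^2}}\,\frac{\beta}{\sqrt{2\pi\cosh\delta}}\int_{-\infty}^{\infty}\exp\Big[-\frac{\beta^2}{2}\Big(\frac{t}{\cosh\delta}-t'\Big)^2\Big]f(t')\,dt'.$$ The heat channel is the channel $\tilde g=\boldsymbol P_\delta^{(\gamma)}f+n$ with real-valued finite-energy input signals $f$ and, independent of the input, white Gaussian noise $n$ of two-sided power spectral density $\theta^2$; that is, the output is observed through $\langle \boldsymbol P_\delta^{(\gamma)}f,\varphi\rangle+\langle n,\varphi\rangle$, $\varphi\in L^2(\mathbb R)$, where $(\langle n,\varphi\rangle)_\varphi$ is a centred Gaussian process with covariance $\mathbb E[\langle n,\varphi\rangle\langle n,\psi\rangle]=\theta^2\langle\varphi,\psi\rangle$. Its capacity $C$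 (in nats per transmission) for average input energy $S$ is the supremum of the mutual information between input and output over all random input signals $f$ with $\mathbb E\|f\|^2\le S$. Let $S=S(\alpha\beta)\ge 0$ depend on $\alpha\beta$ only, with $S(\alpha\beta)=O(\alpha\beta)$ as $\alpha\beta\to\infty$. Write $A\doteq B$ if $(A-B)/(\alpha\beta)\to0$ as $\alpha\beta\to\infty$, let $x^+=\max\{0,x\}$, and let $$N(t,\omega)=\frac{\theta^2}{2\pi}\,(\cosh\delta)\,\exp\Big(\frac{t^2}{\alpha^2}+\frac{\omega^2}{\beta^2}\Big).$$ Then, for all $\alpha,\beta>0$ with $\alpha\beta>1$, $C$ is finite and equals the capacity, under the constraint $\mathbb E\sum_kX_k^2\le S$, of the vector Gaussian channel $Y_k=X_k+Z_k$, $k=0,1,\dots$, with independent noise $Z_k\sim\mathcal N(0,\theta^2\rho^{-2k-1})$. There is a function $\nu=\nu(\alpha\beta)$ with $$S\doteq\iint_{\mathbb R^2}(\nu-N(t,\omega))^+\,dt\,d\omega,$$ and for every such $\nu$ $$C\doteq\frac1{2\pi}\iint_{\mathbb R^2}\frac12\ln\Big(1+\frac{(\nu-N(t,\omega))^+}{N(t,\omega)}\Big)\,dt\,d\omega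 .$$ -/

import Mathlib

open MeasureTheory ProbabilityTheory Filter Topology Asymptotics
open scoped ENNReal NNReal

noncomputable section

namespace HeatChannel

/-! ### The filter -/

/-- The parameter `δ > 0` determined by `coth δ = αβ`, for `αβ > 1`. -/
def delta (α β : ℝ) : ℝ := Real.artanh (1 / (α * β))

/-- The defining property of `delta`. -/
lemma delta_spec {α β : ℝ} (h : 1 < α * β) :
    0 < delta α β ∧ Real.cosh (delta α β) / Real.sinh (delta α β) = α * β := by
  have hpos : 0 < α * β := by linarith
  have hlt : 1 / (α * β) < 1 := by rw [div_lt_one hpos]; exact h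
  have h0 : 0 < 1 / (α * β) := by positivity
  have hmem : 1 / (α * β) ∈ Set.Ioo (-1 : ℝ) 1 := ⟨by linarith, hlt⟩
  have htanh : Real.tanh (delta α β) = 1 / (α * β) := Real.tanh_artanh hmem
  have hsinh : 0 < Real.sinh (delta α β) := by
    rw [Real.tanh_eq_sinh_div_cosh] at htanh
    rw [(div_eq_iff (Real.cosh_pos _).ne').1 htanh]
    exact mul_pos h0 (Real.cosh_pos _)
  refine ⟨Real.sinh_pos_iff.1 hsinh, ?_⟩
  rw [← inv_div, ← Real.tanh_eq_sinh_div_cosh, htanh, one_div, inv_inv]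

/-- `ρ = e^{-δ}`. -/
def rho (α β : ℝ) : ℝ := Real.exp (-delta α β)

/-- The linear time-varying Gaussian filter `P_δ^(γ)` (with `γ² = α/β` and `coth δ = αβ`). -/
def heatFilter (α β : ℝ) (f : ℝ → ℝ) (t : ℝ) : ℝ :=
  Real.exp (-(t ^ 2 / (2 * α ^ 2))) *
    (β / √(2 * Real.pi * Real.cosh (delta α β)) *
      ∫ t' : ℝ, Real.exp (-(β ^ 2 / 2) * (t / Real.cosh (delta α β) - t') ^ 2) * f t')

/-! ### Signals and noise -/

/-- Real-valued signals of finite energy, up to equality almost everywhere. -/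
abbrev Signal : Type := Lp ℝ 2 (volume : Measure ℝ)

instance : MeasurableSpace Signal := borel Signal

instance : BorelSpace Signal := ⟨rfl⟩

/-- White Gaussian noise of two-sided power spectral density `N` on the real line: the family of
the random variables `n φ = ⟨n, φ⟩`, for `φ` in `L²(ℝ)`, is a centred Gaussian process with
`E[⟨n, φ⟩ ⟨n, ψ⟩] = N ⟨φ, ψ⟩`. -/
structure IsWhiteNoise {Ω : Type*} [MeasurableSpace Ω] (P : Measure Ω) (n : Signal → Ω → ℝ)
    (N : ℝ) : Prop where
  measurable : ∀ φ, Measurable (n φ)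
  gaussian : IsGaussianProcess n P
  mean_zero : ∀ φ, ∫ ω, n φ ω ∂P = 0
  covariance : ∀ φ ψ : Signal, ∫ ω, n φ ω * n ψ ω ∂P = N * inner ℝ φ ψ

/-! ### Mutual information and capacity -/

/-- The mutual information (in nats) of the two components of a random pair with joint law `π`:
the Kullback-Leibler divergence of `π` from the product of its marginals. -/
def mutualInfo {X Y : Type*} [MeasurableSpace X] [MeasurableSpace Y] (π : Measure (X × Y)) :
    ℝ≥0∞ :=
  InformationTheory.klDiv π (π.fst.prod π.snd)

/-- The joint law of input and output of the heat channel `g̃ = P_δ^(γ) f + n`, when the input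
signal `f` has law `μ` and is independent of the noise. The output is observed as a generalized
random process: through all its inner products `⟨g̃, φ⟩ = ⟨P_δ^(γ) f, φ⟩ + ⟨n, φ⟩` with
`φ` in `L²(ℝ)`. -/
def jointLaw {Ω : Type*} [MeasurableSpace Ω] (P : Measure Ω) (n : Signal → Ω → ℝ) (α β : ℝ)
    (μ : Measure Signal) : Measure (Signal × (Signal → ℝ)) :=
  (μ.prod P).map fun q : Signal × Ω =>
    (q.1, fun φ : Signal => (∫ t, heatFilter α β q.1 t * φ t) + n φ q.2)

/-- The capacity (in nats per transmission) of the heat channel under the constraint that the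
average energy of the input signal is at most `S`. -/
def capacity {Ω : Type*} [MeasurableSpace Ω] (P : Measure Ω) (n : Signal → Ω → ℝ)
    (α β S : ℝ) : ℝ≥0∞ :=
  ⨆ (μ : Measure Signal) (_ : IsProbabilityMeasure μ)
    (_ : ∫⁻ f, ‖f‖ₑ ^ 2 ∂μ ≤ ENNReal.ofReal S), mutualInfo (jointLaw P n α β μ)

/-- The joint law of input and output of the vector Gaussian channel `Y_k = X_k + Z_k`,
`k = 0, 1, …`, with input law `μ` and independent noise `Z_k ∼ N(0, v_k)`. -/
def parallelJointLaw (v : ℕ → ℝ≥0) (μ : Measure (ℕ → ℝ)) : Measure ((ℕ → ℝ) × (ℕ → ℝ)) :=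
  (μ.prod (Measure.infinitePi fun k => gaussianReal 0 (v k))).map fun q => (q.1, q.1 + q.2)

/-- The capacity (in nats) of the vector Gaussian channel with noise variances `v_k` under the
constraint `E ∑ X_k² ≤ S`. -/
def parallelCapacity (v : ℕ → ℝ≥0) (S : ℝ) : ℝ≥0∞ :=
  ⨆ (μ : Measure (ℕ → ℝ)) (_ : IsProbabilityMeasure μ)
    (_ : ∫⁻ x, ∑' k, ‖x k‖ₑ ^ 2 ∂μ ≤ ENNReal.ofReal S), mutualInfo (parallelJointLaw v μ)

/-- The variance `θ² ρ^{-2k-1}` of the noise in the `k`th subchannel. -/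
def subchannelVar (θ α β : ℝ) (k : ℕ) : ℝ≥0 :=
  (θ ^ 2 * rho α β ^ (-(2 * (k : ℤ)) - 1)).toNNReal

/-! ### The time-frequency plane -/

/-- `N(t, ω) = (θ²/2π) cosh δ exp(t²/α² + ω²/β²)`. -/
def noiseTF (θ α β t ω : ℝ) : ℝ :=
  θ ^ 2 / (2 * Real.pi) * Real.cosh (delta α β) * Real.exp (t ^ 2 / α ^ 2 + ω ^ 2 / β ^ 2)

/-- `∬ (ν - N(t, ω))⁺ dt dω`. -/
def energyIntegral (θ α β ν : ℝ) : ℝ :=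
  ∫ p : ℝ × ℝ, max 0 (ν - noiseTF θ α β p.1 p.2)

/-- `(1/2π) ∬ ½ ln(1 + (ν - N(t, ω))⁺ / N(t, ω)) dt dω`. -/
def capacityIntegral (θ α β ν : ℝ) : ℝ :=
  1 / (2 * Real.pi) *
    ∫ p : ℝ × ℝ,
      1 / 2 * Real.log (1 + max 0 (ν - noiseTF θ α β p.1 p.2) / noiseTF θ α β p.1 p.2)

/-- `A ≐ B`: `(A - B)/(αβ) → 0` as `αβ → ∞`, for functions of `α, β > 0`. The limit is uniform in
the pairs `(α, β)` with the same product, so for functions of the product alone this is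
`A(x) = B(x) + o(x)` as `x → ∞`. -/
def Doteq (A B : ℝ → ℝ → ℝ) : Prop :=
  Tendsto (fun p : ℝ × ℝ => (A p.1 p.2 - B p.1 p.2) / (p.1 * p.2))
    (comap (fun p : ℝ × ℝ => p.1 * p.2) atTop ⊓ 𝓟 {p | 0 < p.1 ∧ 0 < p.2}) (𝓝 0)

end HeatChannel

end

/-! The filter has a symmetric Gaussian kernel. Completing the square shows that it maps t^k
exp(-βt²/(2α)) to ρ^(k+1/2) times itself plus lower functions of the same kind. So it is triangular
on a total sequence and, being symmetric, diagonal in the Gram-Schmidt basis of that sequence, with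
eigenvalues ρ^(k+1/2) (`exists_hilbertBasis_heatOperator`). White noise has i.i.d. coordinates in
this basis, and dividing the k-th output coordinate by its eigenvalue leaves noise of variance
θ²ρ^(-2k-1). Either channel is obtained from the other by measurable processing of input and output,
so data processing in both directions identifies the capacities (`mutualInfo_jointLaw`,
`capacity_eq_parallelCapacity`).

The vector channel obeys water-filling (`parallelCapacity_eq`). Mutual information is at most the
divergence of the joint law from μ ⊗ Q for any output law Q. Taking for Q the output law of the
optimal Gaussian input makes this divergence a function of the second moments alone. Infinitely many
outputs are reached from finitely many by `klDiv_le_of_forall_map_le`, which rests on the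
Donsker-Varadhan principle and martingale convergence.

With water level θ²a and noise variances θ²exp(δ(2k+1)), energy and capacity are midpoint sums of
step 2δ for (a - e^u)⁺ and (ln a - u)⁺. By scaling and polar coordinates with u = r², the plane
integrals become integrals of the same functions, with a replaced by b = max(1, ν/`noiseFloor`). As
αβ → ∞, αβδ → 1 and cosh δ → 1, while S = O(αβ) keeps a bounded, so sums and integrals differ by
O(δ). Agreement of the energies passes to the capacities because ln² a is a Lipschitz function of a
ln a - a + 1 (`sq_sub_sq_le_entropy`). -/

namespace HeatChannel

open InformationTheory

/-! ### Variational principles for the Kullback-Leibler divergence -/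

section KL

variable {X Y : Type*} [MeasurableSpace X] [MeasurableSpace Y]

/-- Gibbs' variational inequality for bounded functions. -/
lemma integral_le_add_log_of_klDiv_le {μ ν : Measure X} [IsProbabilityMeasure μ]
    [IsProbabilityMeasure ν] {C R : ℝ} (hC : 0 ≤ C) (h : klDiv μ ν ≤ ENNReal.ofReal C)
    {g : X → ℝ} (hg : Measurable g) (hR : ∀ x, |g x| ≤ R) :
    ∫ x, g x ∂μ ≤ C + Real.log (∫ x, Real.exp (g x) ∂ν) := by
  have hfin : klDiv μ ν ≠ ∞ := ne_top_of_le_ne_top ENNReal.ofReal_ne_top h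
  obtain ⟨hac, hint⟩ := klDiv_ne_top_iff.1 hfin
  have hgμ : Integrable g μ :=
    Integrable.of_bound hg.aestronglyMeasurable R (ae_of_all _ fun x => by simpa using hR x)
  have hgν : Integrable (fun x => Real.exp (g x)) ν := by
    refine Integrable.of_bound (by fun_prop) (Real.exp R) (ae_of_all _ fun x => ?_)
    rw [Real.norm_eq_abs, Real.abs_exp]
    exact Real.exp_le_exp.2 ((le_abs_self _).trans (hR x))
  have hprob : IsProbabilityMeasure (ν.tilted g) := isProbabilityMeasure_tilted hgν
  have hac' : μ ≪ ν.tilted g := hac.trans (absolutelyContinuous_tilted hgν)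
  have h1 := integral_llr_tilted_right hac hgμ hgν hint
  -- The claim is the nonnegativity of the divergence of `μ` from `ν.tilted g`, whose log-likelihood
  -- ratio is that of `μ` and `ν` minus `g` plus the log-normalizer.
  have h2 := integral_llr_add_sub_measure_univ_nonneg hac'
    (integrable_llr_tilted_right hac hgμ hint hgν)
  have h3 : (klDiv μ ν).toReal ≤ C := ENNReal.toReal_le_of_le_ofReal hC h
  rw [toReal_klDiv_of_measure_eq hac (by simp)] at h3
  simp only [probReal_univ, add_sub_cancel_right] at h2
  linarith

lemma abs_log_clamp {m x : ℝ} (hm : 0 ≤ m) :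
    |Real.log (max (Real.exp (-m)) (min x (Real.exp m)))| ≤ m := by
  have h0 : 0 < max (Real.exp (-m)) (min x (Real.exp m)) := lt_max_of_lt_left (Real.exp_pos _)
  rw [abs_le]
  constructor
  · rw [Real.le_log_iff_exp_le h0]
    exact le_max_left _ _
  · rw [Real.log_le_iff_le_exp h0]
    exact max_le (Real.exp_le_exp.2 (by linarith)) (min_le_right _ _)

/-- Nonnegativity of the truncated `klFun`, needed for Fatou. Below the lower clamp the expression
decreases in `x`, so its value at exp(-m) bounds it; above the upper one `1 ≤ m` suffices. -/
lemma clamp_mul_nonneg {m x : ℝ} (hm : 1 ≤ m) (hx : 0 ≤ x) :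
    0 ≤ x * Real.log (max (Real.exp (-m)) (min x (Real.exp m))) + 1 - x := by
  have hk : ∀ y : ℝ, 0 ≤ y → 0 ≤ y * Real.log y + 1 - y := fun y hy => klFun_nonneg hy
  rcases le_total x (Real.exp m) with h | h
  · rw [min_eq_left h]
    rcases le_total (Real.exp (-m)) x with h' | h'
    · rw [max_eq_right h']
      exact hk x hx
    · rw [max_eq_left h', Real.log_exp]
      have h1 := hk (Real.exp (-m)) (Real.exp_pos _).le
      rw [Real.log_exp] at h1
      nlinarith
  · rw [min_eq_right h, max_eq_right (Real.exp_le_exp.2 (by linarith)), Real.log_exp]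
    nlinarith

/-- The converse half of the Donsker-Varadhan variational principle. -/
lemma klDiv_le_of_forall_integral_le {μ ν : Measure X} [IsProbabilityMeasure μ]
    [IsProbabilityMeasure ν] {C : ℝ}
    (h : ∀ g : X → ℝ, Measurable g → (∃ R, ∀ x, |g x| ≤ R) →
      ∫ x, g x ∂μ ≤ C + Real.log (∫ x, Real.exp (g x) ∂ν)) :
    klDiv μ ν ≤ ENNReal.ofReal C := by
  have hac : μ ≪ ν := by
    -- On a `ν`-null set `s`, the test functions M·1_s give M μ(s) ≤ C for every M ≥ 0, hence μ(s) =
    -- 0.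
    refine Measure.AbsolutelyContinuous.mk fun s hs hνs => ?_
    by_contra hμs
    have hpos : 0 < μ.real s := by
      rw [measureReal_def]
      exact ENNReal.toReal_pos hμs (measure_ne_top _ _)
    have key : ∀ M : ℝ, 0 ≤ M → M * μ.real s ≤ C := by
      intro M hM
      have := h (s.indicator fun _ => M) (measurable_const.indicator hs) ⟨M, fun x => by
        by_cases hx : x ∈ s <;> simp [hx, abs_of_nonneg hM, hM]⟩
      have h1 : ∫ x, Real.exp (s.indicator (fun _ => M) x) ∂ν = 1 := by
        have : (fun x => Real.exp (s.indicator (fun _ => M) x)) =ᵐ[ν] fun _ => 1 := by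
          have hae : ∀ᵐ x ∂ν, x ∉ s := measure_eq_zero_iff_ae_notMem.1 hνs
          filter_upwards [hae] with x hx
          simp [hx]
        rw [integral_congr_ae this]
        simp
      rw [h1, integral_indicator hs] at this
      simpa [mul_comm] using this
    have := key ((|C| + 1) / μ.real s) (by positivity)
    rw [div_mul_cancel₀ _ hpos.ne'] at this
    linarith [le_abs_self C]
  set f : X → ℝ := fun x => (μ.rnDeriv ν x).toReal with hf
  have hfm : Measurable f := (Measure.measurable_rnDeriv _ _).ennreal_toReal
  have hfi : Integrable f ν := Measure.integrable_toReal_rnDeriv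
  have hfint : ∫ x, f x ∂ν = 1 := by
    rw [hf, Measure.integral_toReal_rnDeriv hac]; simp
  -- The optimal test function is the logarithm of the density; clamping makes it bounded. The shift
  -- to m + 1 provides the `1 ≤ m` of `clamp_mul_nonneg`.
  let c : ℕ → X → ℝ := fun m x => max (Real.exp (-(m + 1 : ℝ))) (min (f x) (Real.exp (m + 1)))
  have hcm : ∀ m, Measurable (c m) := fun m => by fun_prop
  have hbd : ∀ m x, |Real.log (c m x)| ≤ m + 1 := fun m x => abs_log_clamp (by positivity)
  have hlm : ∀ m, Measurable fun x => Real.log (c m x) := fun m => (hcm m).log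
  have hint : ∀ m, Integrable (fun x => f x * Real.log (c m x)) ν := fun m =>
    hfi.mul_bdd (c := (m : ℝ) + 1) (hlm m).aestronglyMeasurable
      (ae_of_all _ fun x => by simpa using hbd m x)
  have hb : ∀ m : ℕ, ∫⁻ x, ENNReal.ofReal (f x * Real.log (c m x) + 1 - f x) ∂ν ≤
      ENNReal.ofReal (C + Real.exp (-(m + 1 : ℝ))) := by
    intro m
    have hi2 : Integrable (fun x => f x * Real.log (c m x) + 1 - f x) ν :=
      ((hint m).add (integrable_const 1)).sub hfi
    rw [← ofReal_integral_eq_lintegral_ofReal hi2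
      (ae_of_all _ fun x => clamp_mul_nonneg (by simp) ENNReal.toReal_nonneg)]
    refine ENNReal.ofReal_le_ofReal ?_
    have e1 : ∫ x, f x * Real.log (c m x) + 1 - f x ∂ν = ∫ x, Real.log (c m x) ∂μ := by
      rw [integral_sub (f := fun x => f x * Real.log (c m x) + 1) ((hint m).add (integrable_const 1)) hfi,
        integral_add (hint m) (integrable_const 1), hfint]
      have := integral_toReal_rnDeriv_mul (f := fun x => Real.log (c m x)) hac
      rw [← this]
      simp [hf]
    rw [e1]
    refine (h _ (hlm m) ⟨_, hbd m⟩).trans ?_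
    gcongr
    have hci : Integrable (c m) ν := by
      refine Integrable.of_bound (hcm m).aestronglyMeasurable (Real.exp (m + 1))
        (ae_of_all _ fun x => ?_)
      have h0 : 0 < c m x := lt_max_of_lt_left (Real.exp_pos _)
      rw [Real.norm_eq_abs, abs_of_pos h0]
      exact max_le (Real.exp_le_exp.2 (by linarith)) (min_le_right _ _)
    -- The lower clamp adds at most exp(-(m+1)) to a density of integral 1, so the logarithmic term
    -- vanishes in the limit.
    have e2 : ∫ x, Real.exp (Real.log (c m x)) ∂ν ≤ 1 + Real.exp (-(m + 1 : ℝ)) := by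
      calc ∫ x, Real.exp (Real.log (c m x)) ∂ν = ∫ x, c m x ∂ν := by
            congr with x
            exact Real.exp_log (lt_max_of_lt_left (Real.exp_pos _))
        _ ≤ ∫ x, (f x + Real.exp (-(m + 1 : ℝ))) ∂ν := by
            refine integral_mono hci (hfi.add (integrable_const _)) fun x => ?_
            have : 0 ≤ f x := ENNReal.toReal_nonneg
            exact max_le (by linarith) ((min_le_left _ _).trans (by linarith [Real.exp_pos (-(m + 1 : ℝ))]))
        _ = 1 + Real.exp (-(m + 1 : ℝ)) := by
            rw [integral_add hfi (integrable_const _), hfint]; simp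
    have hpos : 0 < ∫ x, Real.exp (Real.log (c m x)) ∂ν := by
      refine integral_exp_pos ?_
      refine hci.congr (ae_of_all _ fun x => ?_)
      exact (Real.exp_log (lt_max_of_lt_left (Real.exp_pos _))).symm
    linarith [Real.log_le_sub_one_of_pos hpos]
  rw [klDiv_eq_lintegral_klFun_of_ac hac]
  have htend : ∀ x, Tendsto (fun m => ENNReal.ofReal (f x * Real.log (c m x) + 1 - f x)) atTop
      (𝓝 (ENNReal.ofReal (klFun (f x)))) := by
    intro x
    refine tendsto_const_nhds.congr' ?_
    have hfx : 0 ≤ f x := ENNReal.toReal_nonneg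
    rcases hfx.eq_or_lt with h0 | h0
    · filter_upwards with m
      simp [← h0, klFun]
    · have t1 : Tendsto (fun m : ℕ => Real.exp (-(m + 1 : ℝ))) atTop (𝓝 0) :=
        Real.tendsto_exp_neg_atTop_nhds_zero.comp
          (tendsto_atTop_add_const_right _ _ tendsto_natCast_atTop_atTop)
      have t2 : Tendsto (fun m : ℕ => Real.exp (m + 1 : ℝ)) atTop atTop :=
        Real.tendsto_exp_atTop.comp
          (tendsto_atTop_add_const_right _ _ tendsto_natCast_atTop_atTop)
      filter_upwards [t1.eventually_le_const h0, t2.eventually_ge_atTop (f x)] with m h1 h2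
      simp only [c, min_eq_left h2, max_eq_right h1, klFun]
  -- Fatou: the truncated integrands are nonnegative and eventually equal to `klFun` of the density
  -- at each point.
  calc ∫⁻ x, ENNReal.ofReal (klFun (μ.rnDeriv ν x).toReal) ∂ν
      = ∫⁻ x, liminf (fun m => ENNReal.ofReal (f x * Real.log (c m x) + 1 - f x)) atTop ∂ν := by
        congr with x
        exact (htend x).liminf_eq.symm
    _ ≤ liminf (fun m => ∫⁻ x, ENNReal.ofReal (f x * Real.log (c m x) + 1 - f x) ∂ν) atTop :=
        lintegral_liminf_le fun m => by fun_prop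
    _ ≤ liminf (fun m : ℕ => ENNReal.ofReal (C + Real.exp (-(m + 1 : ℝ)))) atTop :=
        liminf_le_liminf (Eventually.of_forall hb)
    _ = ENNReal.ofReal C := by
        refine Tendsto.liminf_eq ?_
        refine ENNReal.tendsto_ofReal ?_
        have t1 : Tendsto (fun m : ℕ => Real.exp (-(m + 1 : ℝ))) atTop (𝓝 0) :=
          Real.tendsto_exp_neg_atTop_nhds_zero.comp
            (tendsto_atTop_add_const_right _ _ tendsto_natCast_atTop_atTop)
        simpa using t1.const_add C

/-- The Kullback-Leibler divergence is the supremum of its values on an increasing sequence of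
`σ`-algebras that generate everything. -/
lemma klDiv_le_of_forall_map_le {Z : ℕ → Type*} [∀ n, MeasurableSpace (Z n)]
    {r : ∀ n, X → Z n} (hr : ∀ n, Measurable (r n))
    (hmono : Monotone fun n => MeasurableSpace.comap (r n) inferInstance)
    (hsup : ‹MeasurableSpace X› ≤ ⨆ n, MeasurableSpace.comap (r n) inferInstance)
    {μ ν : Measure X} [IsProbabilityMeasure μ] [IsProbabilityMeasure ν] {C : ℝ} (hC : 0 ≤ C)
    (h : ∀ n, klDiv (μ.map (r n)) (ν.map (r n)) ≤ ENNReal.ofReal C) :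
    klDiv μ ν ≤ ENNReal.ofReal C := by
  refine klDiv_le_of_forall_integral_le ?_
  rintro g hg ⟨R, hR⟩
  let F : Filtration ℕ ‹MeasurableSpace X› :=
    ⟨fun n => MeasurableSpace.comap (r n) inferInstance, hmono, fun n => (hr n).comap_le⟩
  -- Conditioning under `μ + ν` makes Lévy's upward theorem hold almost everywhere for both measures
  -- at once.
  have hgi : Integrable g (μ + ν) :=
    Integrable.of_bound hg.aestronglyMeasurable R (ae_of_all _ fun x => by simpa using hR x)
  have hlim := hgi.tendsto_ae_condExp (ℱ := F)
    (hg.mono hsup le_rfl : Measurable[⨆ n, F n] g).stronglyMeasurable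
  have hfac : ∀ n, ∃ φ : Z n → ℝ, StronglyMeasurable φ ∧ (μ + ν)[g | F n] = φ ∘ r n := fun n =>
    (stronglyMeasurable_condExp (f := g) (m := F n) (μ := μ + ν)).exists_eq_measurable_comp
  choose φ hφm hφ using hfac
  -- The factor `φ n` of the conditional expectation is not known to be bounded everywhere. Clamping
  -- it to [-R, R] repairs this and leaves the limit `g` unchanged.
  have hclamp : ∀ n z, |max (-R) (min (φ n z) R)| ≤ |R| := by
    intro n z
    refine abs_le.2 ⟨?_, ?_⟩
    · exact (neg_le_neg (le_abs_self R)).trans (le_max_left _ _)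
    · exact max_le (neg_le_abs R) ((min_le_right _ _).trans (le_abs_self R))
  have hstep : ∀ n, ∫ x, max (-R) (min (φ n (r n x)) R) ∂μ ≤
      C + Real.log (∫ x, Real.exp (max (-R) (min (φ n (r n x)) R)) ∂ν) := by
    intro n
    have := Measure.isProbabilityMeasure_map (μ := μ) (hr n).aemeasurable
    have := Measure.isProbabilityMeasure_map (μ := ν) (hr n).aemeasurable
    have hm : Measurable fun z => max (-R) (min (φ n z) R) := by
      have := (hφm n).measurable
      fun_prop
    have key := integral_le_add_log_of_klDiv_le hC (h n) hm (hclamp n)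
    rwa [integral_map (hr n).aemeasurable hm.aestronglyMeasurable,
      integral_map (hr n).aemeasurable hm.exp.aestronglyMeasurable] at key
  have hpt : ∀ᵐ x ∂(μ + ν), Tendsto (fun n => max (-R) (min (φ n (r n x)) R)) atTop (𝓝 (g x)) := by
    filter_upwards [hlim] with x hx
    have h1 : max (-R) (min (g x) R) = g x := by
      have := abs_le.1 (hR x)
      rw [min_eq_left this.2, max_eq_right this.1]
    have h2 := (tendsto_const_nhds (x := -R)).max (hx.min (tendsto_const_nhds (x := R)))
    rw [h1] at h2
    refine h2.congr fun n => ?_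
    rw [hφ n, Function.comp_apply]
  rw [ae_add_measure_iff] at hpt
  have hm : ∀ n, Measurable fun x => max (-R) (min (φ n (r n x)) R) := fun n => by
    have := (hφm n).measurable.comp (hr n)
    simp only [Function.comp_def] at this
    fun_prop
  have l1 : Tendsto (fun n => ∫ x, max (-R) (min (φ n (r n x)) R) ∂μ) atTop (𝓝 (∫ x, g x ∂μ)) :=
    tendsto_integral_of_dominated_convergence (fun _ => |R|) (fun n => (hm n).aestronglyMeasurable)
      (integrable_const _) (fun n => ae_of_all _ fun x => hclamp n _) hpt.1
  have l2 : Tendsto (fun n => ∫ x, Real.exp (max (-R) (min (φ n (r n x)) R)) ∂ν) atTop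
      (𝓝 (∫ x, Real.exp (g x) ∂ν)) := by
    refine tendsto_integral_of_dominated_convergence (fun _ => Real.exp |R|)
      (fun n => (hm n).exp.aestronglyMeasurable)
      (integrable_const _) (fun n => ae_of_all _ fun x => ?_) ?_
    · rw [Real.norm_eq_abs, Real.abs_exp]
      exact Real.exp_le_exp.2 ((le_abs_self _).trans (hclamp n _))
    · filter_upwards [hpt.2] with x hx
      exact (Real.continuous_exp.tendsto _).comp hx
  have hpos : 0 < ∫ x, Real.exp (g x) ∂ν := by
    refine integral_exp_pos (Integrable.of_bound (by fun_prop) (Real.exp R)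
      (ae_of_all _ fun x => ?_))
    rw [Real.norm_eq_abs, Real.abs_exp]
    exact Real.exp_le_exp.2 ((le_abs_self _).trans (hR x))
  exact le_of_tendsto_of_tendsto' l1 ((l2.log hpos.ne').const_add C) hstep

lemma klDiv_map_measurableEquiv (e : X ≃ᵐ Y) (μ ν : Measure X) [IsFiniteMeasure μ]
    [IsFiniteMeasure ν] : klDiv (μ.map e) (ν.map e) = klDiv μ ν := by
  refine le_antisymm (klDiv_map_le _ _ e.measurable) ?_
  have := klDiv_map_le (μ.map e) (ν.map e) e.symm.measurable
  rwa [MeasurableEquiv.map_symm_map, MeasurableEquiv.map_symm_map] at this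

/-- Among all product measures with the given first marginal, the product of the marginals is the
closest one to a joint law. -/
lemma mutualInfo_le_klDiv_prod [StandardBorelSpace X] [Nonempty X] (π : Measure (X × Y))
    [IsProbabilityMeasure π] (Q : Measure Y) [IsProbabilityMeasure Q] :
    mutualInfo π ≤ klDiv π (π.fst.prod Q) := by
  -- With the output as base, the chain rule gives D(π ‖ π.fst ⊗ Q) = D(π.snd ‖ Q) + I(π). The
  -- standard Borel hypothesis supplies the conditional law of the input given the output.
  set π' : Measure (Y × X) := π.map Prod.swap with hπ'
  have : IsProbabilityMeasure π' := Measure.isProbabilityMeasure_map measurable_swap.aemeasurable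
  have hfst : π'.fst = π.snd := Measure.fst_map_swap
  have hd : π.snd ⊗ₘ π'.condKernel = π' := by rw [← hfst]; exact π'.disintegrate π'.condKernel
  have hsw : ∀ Q' : Measure Y, IsProbabilityMeasure Q' →
      klDiv π (π.fst.prod Q') = klDiv π' (Q' ⊗ₘ Kernel.const Y π.fst) := by
    intro Q' _
    have h : (π.fst.prod Q').map (MeasurableEquiv.prodComm (α := X) (β := Y)) = Q'.prod π.fst :=
      Measure.prod_swap
    rw [Measure.compProd_const, ← h]
    exact (klDiv_map_measurableEquiv (MeasurableEquiv.prodComm (α := X) (β := Y)) π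
      (π.fst.prod Q')).symm
  rw [mutualInfo, hsw _ inferInstance, hsw _ inferInstance]
  nth_rw 2 [← hd]
  rw [klDiv_compProd_eq_add, hd]
  exact le_add_self

/-- Processing the input and the output separately does not increase the mutual information. -/
lemma mutualInfo_map_prodMap_le {X' Y' : Type*} [MeasurableSpace X'] [MeasurableSpace Y']
    (π : Measure (X × Y)) [IsProbabilityMeasure π] {F : X → X'} {H : Y → Y'} (hF : Measurable F)
    (hH : Measurable H) : mutualInfo (π.map (Prod.map F H)) ≤ mutualInfo π := by
  have h1 : (π.map (Prod.map F H)).fst = π.fst.map F := by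
    rw [Measure.fst, Measure.fst, Measure.map_map measurable_fst (hF.prodMap hH),
      Measure.map_map hF measurable_fst]
    rfl
  have h2 : (π.map (Prod.map F H)).snd = π.snd.map H := by
    rw [Measure.snd, Measure.snd, Measure.map_map measurable_snd (hF.prodMap hH),
      Measure.map_map hH measurable_snd]
    rfl
  rw [mutualInfo, h1, h2, Measure.map_prod_map _ _ hF hH, mutualInfo]
  exact klDiv_map_le _ _ (hF.prodMap hH)

end KL

/-! ### Densities of the vector Gaussian channel with finitely many outputs -/

section Parallel

/-- The logarithm of the density of `N(x, v)` with respect to `N(0, w)`. -/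
noncomputable def gaussianLogRatio (v w : ℝ≥0) (x y : ℝ) : ℝ :=
  1 / 2 * Real.log (w / v) - (y - x) ^ 2 / (2 * v) + y ^ 2 / (2 * w)

@[fun_prop]
lemma measurable_gaussianLogRatio (v w : ℝ≥0) {Z : Type*} [MeasurableSpace Z] {f g : Z → ℝ}
    (hf : Measurable f) (hg : Measurable g) :
    Measurable fun z => gaussianLogRatio v w (f z) (g z) := by
  unfold gaussianLogRatio
  fun_prop

lemma gaussianReal_withDensity_logRatio {v w : ℝ≥0} (hv : v ≠ 0) (hw : w ≠ 0) (x : ℝ) :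
    (gaussianReal 0 w).withDensity (fun y => ENNReal.ofReal (Real.exp (gaussianLogRatio v w x y))) =
      gaussianReal x v := by
  have hv' : (0 : ℝ) < v := by positivity
  have hw' : (0 : ℝ) < w := by positivity
  rw [gaussianReal_of_var_ne_zero _ hw, gaussianReal_of_var_ne_zero _ hv,
    ← withDensity_mul _ (measurable_gaussianPDF _ _) (by fun_prop)]
  congr with y
  rw [Pi.mul_apply, gaussianPDF, gaussianPDF, ← ENNReal.ofReal_mul (gaussianPDFReal_nonneg _ _ _)]
  congr 1
  have e : Real.exp (1 / 2 * Real.log (w / v)) = √(2 * Real.pi * w) / √(2 * Real.pi * v) := by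
    rw [← Real.sqrt_div (by positivity), mul_div_mul_left _ _ (by positivity),
      Real.sqrt_eq_rpow, Real.rpow_def_of_pos (by positivity), mul_comm]
  have hs : √(2 * Real.pi * w) ≠ 0 := by positivity
  rw [gaussianPDFReal, gaussianPDFReal, gaussianLogRatio, Real.exp_add, Real.exp_sub, e]
  have e2 : Real.exp (-(y - 0) ^ 2 / (2 * w)) * Real.exp (y ^ 2 / (2 * w)) = 1 := by
    rw [← Real.exp_add, ← Real.exp_zero]; congr 1; ring
  have e3 : Real.exp (-(y - x) ^ 2 / (2 * v)) = (Real.exp ((y - x) ^ 2 / (2 * v)))⁻¹ := by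
    rw [← Real.exp_neg]; congr 1; ring
  rw [e3]
  calc _ = ((√(2 * Real.pi * w))⁻¹ * √(2 * Real.pi * w)) *
        (Real.exp (-(y - 0) ^ 2 / (2 * w)) * Real.exp (y ^ 2 / (2 * w))) *
        ((√(2 * Real.pi * v))⁻¹ * (Real.exp ((y - x) ^ 2 / (2 * v)))⁻¹) := by ring
    _ = _ := by rw [e2, inv_mul_cancel₀ hs]; ring

lemma pi_withDensity {ι : Type*} [Fintype ι] {X : ι → Type*} [∀ i, MeasurableSpace (X i)]
    (γ : ∀ i, Measure (X i)) [∀ i, IsProbabilityMeasure (γ i)] {f : ∀ i, X i → ℝ≥0∞}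
    (hf : ∀ i, Measurable (f i)) (γ' : ∀ i, Measure (X i)) [∀ i, IsProbabilityMeasure (γ' i)]
    (h : ∀ i, (γ i).withDensity (f i) = γ' i) :
    (Measure.pi γ).withDensity (fun y => ∏ i, f i (y i)) = Measure.pi γ' := by
  refine (Measure.pi_eq fun s hs => ?_).symm
  rw [withDensity_apply _ (MeasurableSet.univ_pi hs), ← lintegral_indicator (MeasurableSet.univ_pi hs)]
  have e : ∀ y, (Set.univ.pi s).indicator (fun y => ∏ i, f i (y i)) y =
      ∏ i, (s i).indicator (f i) (y i) := by
    intro y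
    by_cases hy : y ∈ Set.univ.pi s
    · rw [Set.indicator_of_mem hy]
      exact Finset.prod_congr rfl fun i _ => (Set.indicator_of_mem (hy i trivial) _).symm
    · rw [Set.indicator_of_notMem hy]
      simp only [Set.mem_pi, Set.mem_univ, forall_const, not_forall] at hy
      obtain ⟨i, hi⟩ := hy
      exact (Finset.prod_eq_zero (Finset.mem_univ i) (Set.indicator_of_notMem hi _)).symm
  simp_rw [e]
  rw [lintegral_prod_eq_prod_lintegral_of_indepFun Finset.univ
    (fun i (y : ∀ i, X i) => (s i).indicator (f i) (y i))
    (iIndepFun_pi fun i => ((hf i).indicator (hs i)).aemeasurable)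
    fun i => ((hf i).indicator (hs i)).comp (measurable_pi_apply i)]
  refine Finset.prod_congr rfl fun i _ => ?_
  rw [← h i, withDensity_apply _ (hs i), ← lintegral_indicator (hs i)]
  exact (measurePreserving_eval γ i).lintegral_comp ((hf i).indicator (hs i))

/-- The joint law of the input and of finitely many outputs of the vector Gaussian channel. -/
noncomputable def restrictedJointLaw (v : ℕ → ℝ≥0) (μ : Measure (ℕ → ℝ)) (I : Finset ℕ) :
    Measure ((ℕ → ℝ) × (I → ℝ)) :=
  (μ.prod (Measure.pi fun i : I => gaussianReal 0 (v i))).map fun q => (q.1, I.restrict q.1 + q.2)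

variable (v w : ℕ → ℝ≥0) (μ : Measure (ℕ → ℝ)) (I : Finset ℕ)

instance [IsProbabilityMeasure μ] : IsProbabilityMeasure (restrictedJointLaw v μ I) :=
  Measure.isProbabilityMeasure_map (by fun_prop)

instance [IsProbabilityMeasure μ] : IsProbabilityMeasure (parallelJointLaw v μ) :=
  Measure.isProbabilityMeasure_map (by fun_prop)

lemma parallelJointLaw_map_restrict [IsProbabilityMeasure μ] :
    (parallelJointLaw v μ).map (Prod.map id I.restrict) = restrictedJointLaw v μ I := by
  have hm : Measurable (I.restrict : (ℕ → ℝ) → I → ℝ) := by fun_prop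
  rw [parallelJointLaw, restrictedJointLaw, Measure.map_map (by fun_prop) (by fun_prop),
    ← Measure.infinitePi_map_restrict (fun k => gaussianReal 0 (v k))]
  nth_rw 2 [← Measure.map_id (μ := μ)]
  rw [Measure.map_prod_map _ _ measurable_id hm, Measure.map_map (by fun_prop) (by fun_prop)]
  rfl

lemma restrictedJointLaw_fst : (restrictedJointLaw v μ I).fst = μ := by
  rw [restrictedJointLaw, Measure.fst, Measure.map_map measurable_fst (by fun_prop)]
  exact Measure.fst_prod

/-- Given the input `x`, the outputs are independent N(x_i, v_i). The arbitrary input law is common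
to both sides, so only Gaussian density ratios remain. -/
lemma restrictedJointLaw_eq_withDensity (hv : ∀ k, v k ≠ 0) (hw : ∀ k, w k ≠ 0) :
    restrictedJointLaw v μ I =
      (μ.prod (Measure.pi fun i : I => gaussianReal 0 (w i))).withDensity
        fun q => ENNReal.ofReal (Real.exp (∑ i : I, gaussianLogRatio (v i) (w i) (q.1 i) (q.2 i))) := by
  have hD : Measurable fun q : (ℕ → ℝ) × (I → ℝ) =>
      ENNReal.ofReal (Real.exp (∑ i : I, gaussianLogRatio (v i) (w i) (q.1 i) (q.2 i))) := by
    fun_prop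
  refine Measure.ext_of_lintegral _ fun F hF => ?_
  rw [restrictedJointLaw, lintegral_map hF (by fun_prop),
    lintegral_withDensity_eq_lintegral_mul _ hD hF, lintegral_prod _ (by fun_prop),
    lintegral_prod _ (by fun_prop)]
  refine lintegral_congr fun x => ?_
  have hpi : (Measure.pi fun i : I => gaussianReal 0 (v i)).map (fun z => I.restrict x + z) =
      Measure.pi fun i : I => gaussianReal (x i) (v i) := by
    have := Measure.pi_map_pi (μ := fun i : I => gaussianReal 0 (v i))
      (f := fun (i : I) (z : ℝ) => x i + z) (fun i => by fun_prop)
    simp only [gaussianReal_map_const_add, zero_add] at this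
    exact this
  have hd := pi_withDensity (fun i : I => gaussianReal 0 (w i))
    (f := fun i y => ENNReal.ofReal (Real.exp (gaussianLogRatio (v i) (w i) (x i) y)))
    (fun i => by fun_prop) (fun i : I => gaussianReal (x i) (v i))
    (fun i => gaussianReal_withDensity_logRatio (hv i) (hw i) (x i))
  have hFx : Measurable fun y => F (x, y) := by fun_prop
  calc ∫⁻ z, F (x, I.restrict x + z) ∂(Measure.pi fun i : I => gaussianReal 0 (v i))
      = ∫⁻ y, F (x, y) ∂(Measure.pi fun i : I => gaussianReal (x i) (v i)) := by
        rw [← hpi, lintegral_map hFx (by fun_prop)]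
    _ = _ := by
        rw [← hd, lintegral_withDensity_eq_lintegral_mul _ (by fun_prop) hFx]
        refine lintegral_congr fun y => ?_
        simp only [Pi.mul_apply]
        rw [Real.exp_sum, ENNReal.ofReal_prod_of_nonneg fun _ _ => (Real.exp_pos _).le]

end Parallel

/-! ### Water-filling for the vector Gaussian channel -/

section Parallel

variable (v w : ℕ → ℝ≥0) (μ : Measure (ℕ → ℝ)) [IsProbabilityMeasure μ] (I : Finset ℕ)

lemma integral_sq_gaussianReal (v : ℝ≥0) : ∫ z, z ^ 2 ∂(gaussianReal 0 v) = v := by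
  have h := variance_fun_id_gaussianReal (μ := 0) (v := v)
  rw [variance_eq_integral (by fun_prop)] at h
  simpa using h

lemma integrable_sq_gaussianReal (v : ℝ≥0) : Integrable (fun z => z ^ 2) (gaussianReal 0 v) :=
  (memLp_id_gaussianReal' (μ := 0) (v := v) 2 (by simp)).integrable_sq

/-- Here `x` is an index. For Y = X + Z the log-ratio is quadratic in (X, Z), and the cross term has
mean zero because Z is centred and independent of X; so only second moments survive. -/
lemma integrable_logRatio {x : ℕ} (hx : Integrable (fun f : ℕ → ℝ => f x ^ 2) μ) (a b : ℝ≥0)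
    (γ : Measure (I → ℝ)) [IsProbabilityMeasure γ] (hxI : x ∈ I)
    (hγ : γ.map (fun z => z ⟨x, hxI⟩) = gaussianReal 0 a) (ha : a ≠ 0) (hb : b ≠ 0) :
    Integrable (fun q : (ℕ → ℝ) × (I → ℝ) => gaussianLogRatio a b (q.1 x) (q.1 x + q.2 ⟨x, hxI⟩))
      (μ.prod γ) ∧
    ∫ q, gaussianLogRatio a b (q.1 x) (q.1 x + q.2 ⟨x, hxI⟩) ∂(μ.prod γ) =
      1 / 2 * Real.log (b / a) + (∫ f, f x ^ 2 ∂μ + a - b) / (2 * b) := by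
  have ha' : (a : ℝ) ≠ 0 := by positivity
  have hb' : (b : ℝ) ≠ 0 := by positivity
  have hX2 : MemLp (fun f : ℕ → ℝ => f x) 2 μ :=
    (memLp_two_iff_integrable_sq (measurable_pi_apply x).aestronglyMeasurable).2 hx
  have hX1 : Integrable (fun f : ℕ → ℝ => f x) μ := hX2.integrable (by norm_num)
  have hZ1 : Integrable (fun z : I → ℝ => z ⟨x, hxI⟩) γ := by
    have : Integrable id (gaussianReal 0 a) := (memLp_id_gaussianReal' 1 (by simp)).integrable le_rfl
    rw [← hγ] at this
    exact this.comp_measurable (by fun_prop)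
  have hZ2 : Integrable (fun z : I → ℝ => z ⟨x, hxI⟩ ^ 2) γ := by
    have := integrable_sq_gaussianReal a
    rw [← hγ] at this
    exact this.comp_measurable (by fun_prop)
  have hEZ : ∫ z : I → ℝ, z ⟨x, hxI⟩ ∂γ = 0 := by
    have := integral_id_gaussianReal (μ := 0) (v := a)
    rw [← hγ, integral_map (measurable_pi_apply _).aemeasurable (by fun_prop)] at this
    exact this
  have hEZ2 : ∫ z : I → ℝ, z ⟨x, hxI⟩ ^ 2 ∂γ = a := by
    have := integral_sq_gaussianReal a
    rw [← hγ, integral_map (measurable_pi_apply _).aemeasurable (by fun_prop)] at this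
    exact this
  have i1 : Integrable (fun q : (ℕ → ℝ) × (I → ℝ) => q.1 x ^ 2) (μ.prod γ) := hx.comp_fst _
  have i2 : Integrable (fun q : (ℕ → ℝ) × (I → ℝ) => q.2 ⟨x, hxI⟩ ^ 2) (μ.prod γ) := hZ2.comp_snd _
  have i3 : Integrable (fun q : (ℕ → ℝ) × (I → ℝ) => q.1 x * q.2 ⟨x, hxI⟩) (μ.prod γ) :=
    hX1.mul_prod hZ1
  have e : (fun q : (ℕ → ℝ) × (I → ℝ) => gaussianLogRatio a b (q.1 x) (q.1 x + q.2 ⟨x, hxI⟩)) =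
      fun q => 1 / 2 * Real.log (b / a) + (1 / (2 * b) * q.1 x ^ 2 +
        ((1 / (2 * b) - 1 / (2 * a)) * q.2 ⟨x, hxI⟩ ^ 2 + 1 / b * (q.1 x * q.2 ⟨x, hxI⟩))) := by
    funext q
    rw [gaussianLogRatio]
    field_simp
    ring
  have e1 : ∫ q : (ℕ → ℝ) × (I → ℝ), q.1 x ^ 2 ∂(μ.prod γ) = ∫ f, f x ^ 2 ∂μ := by
    rw [integral_fun_fst (f := fun f : ℕ → ℝ => f x ^ 2)]; simp
  have e2 : ∫ q : (ℕ → ℝ) × (I → ℝ), q.2 ⟨x, hxI⟩ ^ 2 ∂(μ.prod γ) = a := by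
    rw [integral_fun_snd (f := fun z : I → ℝ => z ⟨x, hxI⟩ ^ 2), hEZ2]; simp
  have e3 : ∫ q : (ℕ → ℝ) × (I → ℝ), q.1 x * q.2 ⟨x, hxI⟩ ∂(μ.prod γ) = 0 := by
    rw [integral_prod_mul (fun f : ℕ → ℝ => f x) (fun z : I → ℝ => z ⟨x, hxI⟩), hEZ, mul_zero]
  have j1 := i1.const_mul (1 / (2 * (b : ℝ)))
  have j2 := i2.const_mul (1 / (2 * (b : ℝ)) - 1 / (2 * a))
  have j3 := i3.const_mul (1 / (b : ℝ))
  rw [e]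
  refine ⟨(integrable_const _).add (j1.add (j2.add j3)), ?_⟩
  have j23 : Integrable (fun q : (ℕ → ℝ) × (I → ℝ) =>
      (1 / (2 * b) - 1 / (2 * a)) * q.2 ⟨x, hxI⟩ ^ 2 + 1 / b * (q.1 x * q.2 ⟨x, hxI⟩))
      (μ.prod γ) := j2.add j3
  have j123 : Integrable (fun q : (ℕ → ℝ) × (I → ℝ) => 1 / (2 * b) * q.1 x ^ 2 +
      ((1 / (2 * b) - 1 / (2 * a)) * q.2 ⟨x, hxI⟩ ^ 2 + 1 / b * (q.1 x * q.2 ⟨x, hxI⟩)))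
      (μ.prod γ) := j1.add j23
  rw [integral_add (integrable_const _) j123, integral_add j1 j23, integral_add j2 j3]
  simp only [integral_const_mul, e1, e2, e3, integral_const, probReal_univ, smul_eq_mul]
  field_simp
  ring

/-- The divergence of the joint law from the product of the input law with a centred Gaussian
product measure depends on the second moments of the input only. -/
lemma klDiv_restrictedJointLaw (hv : ∀ k, v k ≠ 0) (hw : ∀ k, w k ≠ 0)
    (hμ : ∀ i ∈ I, Integrable (fun f : ℕ → ℝ => f i ^ 2) μ) :
    klDiv (restrictedJointLaw v μ I) (μ.prod (Measure.pi fun i : I => gaussianReal 0 (w i))) =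
      ENNReal.ofReal (∑ i ∈ I, (1 / 2 * Real.log (w i / v i) +
        (∫ f, f i ^ 2 ∂μ + v i - w i) / (2 * w i))) := by
  set Q := μ.prod (Measure.pi fun i : I => gaussianReal 0 (w i)) with hQ
  have hd := restrictedJointLaw_eq_withDensity v w μ I hv hw
  rw [← hQ] at hd
  have hLm : Measurable fun q : (ℕ → ℝ) × (I → ℝ) =>
      ∑ i : I, gaussianLogRatio (v i) (w i) (q.1 i) (q.2 i) := by fun_prop
  have hac : restrictedJointLaw v μ I ≪ Q := by
    rw [hd]; exact withDensity_absolutelyContinuous _ _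
  have hllr : llr (restrictedJointLaw v μ I) Q =ᵐ[restrictedJointLaw v μ I]
      fun q => ∑ i : I, gaussianLogRatio (v i) (w i) (q.1 i) (q.2 i) := by
    have h1 : (restrictedJointLaw v μ I).rnDeriv Q =ᵐ[Q] fun q => ENNReal.ofReal
        (Real.exp (∑ i : I, gaussianLogRatio (v i) (w i) (q.1 i) (q.2 i))) := by
      rw [hd]
      exact Measure.rnDeriv_withDensity _ (by fun_prop)
    filter_upwards [hac.ae_le h1] with q hq
    rw [llr_def]
    simp only [hq]
    rw [ENNReal.toReal_ofReal (Real.exp_pos _).le, Real.log_exp]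
  have hi : ∀ i : I, _ := fun i => integrable_logRatio μ I (hμ i i.2) (v i) (w i)
    (Measure.pi fun i : I => gaussianReal 0 (v i)) i.2
    ((measurePreserving_eval (fun i : I => gaussianReal 0 (v i)) i).map_eq) (hv i) (hw i)
  have hint : Integrable (fun q : (ℕ → ℝ) × (I → ℝ) =>
      ∑ i : I, gaussianLogRatio (v i) (w i) (q.1 i) (q.2 i)) (restrictedJointLaw v μ I) := by
    rw [restrictedJointLaw, integrable_map_measure hLm.aestronglyMeasurable (by fun_prop)]
    exact integrable_finsetSum _ fun i _ => (hi i).1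
  have hval : ∫ q, ∑ i : I, gaussianLogRatio (v i) (w i) (q.1 i) (q.2 i)
      ∂(restrictedJointLaw v μ I) = ∑ i : I, (1 / 2 * Real.log (w i / v i) +
        (∫ f, f i ^ 2 ∂μ + v i - w i) / (2 * w i)) := by
    rw [restrictedJointLaw, integral_map (by fun_prop) hLm.aestronglyMeasurable]
    refine (integral_finsetSum _ fun i _ => (hi i).1).trans ?_
    exact Finset.sum_congr rfl fun i _ => (hi i).2
  rw [klDiv_of_ac_of_integrable hac (hint.congr hllr.symm), integral_congr_ae hllr, hval]
  simp only [probReal_univ, add_sub_cancel_right]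
  rw [← Finset.sum_coe_sort I]

omit [IsProbabilityMeasure μ] in
lemma integral_sq_sum_le {S : ℝ} (hS : 0 ≤ S)
    (hμ : ∫⁻ x, ∑' k, ‖x k‖ₑ ^ 2 ∂μ ≤ ENNReal.ofReal S) :
    (∀ k, Integrable (fun f : ℕ → ℝ => f k ^ 2) μ) ∧
      ∀ I : Finset ℕ, ∑ i ∈ I, ∫ f, f i ^ 2 ∂μ ≤ S := by
  have hsq : ∀ (f : ℕ → ℝ) k, ‖f k‖ₑ ^ 2 = ENNReal.ofReal (f k ^ 2) := fun f k => by
    rw [Real.enorm_eq_ofReal_abs, ← ENNReal.ofReal_pow (abs_nonneg _), sq_abs]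
  have hle : ∀ I : Finset ℕ, ∑ i ∈ I, ∫⁻ f, ENNReal.ofReal (f i ^ 2) ∂μ ≤ ENNReal.ofReal S := by
    intro I
    rw [← lintegral_finsetSum _ fun i _ => by fun_prop]
    refine (lintegral_mono fun f => ?_).trans hμ
    simp_rw [← hsq]
    exact ENNReal.sum_le_tsum I
  have hint : ∀ k, Integrable (fun f : ℕ → ℝ => f k ^ 2) μ := by
    intro k
    refine ⟨((measurable_pi_apply k).pow_const 2).aestronglyMeasurable, ?_⟩
    rw [hasFiniteIntegral_iff_ofReal (ae_of_all _ fun f => sq_nonneg _)]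
    exact ((by simpa using hle {k} :
      ∫⁻ f, ENNReal.ofReal (f k ^ 2) ∂μ ≤ ENNReal.ofReal S)).trans_lt ENNReal.ofReal_lt_top
  refine ⟨hint, fun I => ?_⟩
  rw [← ENNReal.ofReal_le_ofReal_iff hS, ENNReal.ofReal_sum_of_nonneg fun i _ =>
    integral_nonneg fun f => sq_nonneg _]
  refine le_trans (le_of_eq (Finset.sum_congr rfl fun i _ => ?_)) (hle I)
  exact ofReal_integral_eq_lintegral_ofReal (hint i) (ae_of_all _ fun f => sq_nonneg _)

/-- The full input with the first N + n outputs generates increasing σ-algebras that exhaust the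
product, so a bound uniform in n passes to the limit. The offset `N` permits asking for it only once
all active subchannels are included. -/
lemma mutualInfo_parallelJointLaw_le {C : ℝ} (hC : 0 ≤ C) (N : ℕ)
    (h : ∀ n, N ≤ n → mutualInfo (restrictedJointLaw v μ (Finset.range n)) ≤ ENNReal.ofReal C) :
    mutualInfo (parallelJointLaw v μ) ≤ ENNReal.ofReal C := by
  let r : ∀ n : ℕ, (ℕ → ℝ) × (ℕ → ℝ) → (ℕ → ℝ) × (Finset.range (N + n) → ℝ) :=
    fun n => Prod.map id (Finset.range (N + n)).restrict
  have hr : ∀ n, Measurable (r n) := fun n => by fun_prop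
  refine klDiv_le_of_forall_map_le (r := r) hr ?_ ?_ hC fun n => ?_
  · intro m n hmn
    have hsub : Finset.range (N + m) ⊆ Finset.range (N + n) :=
      Finset.range_subset_range.2 (by omega)
    have : r m = Prod.map id (Finset.restrict₂ (π := fun _ => ℝ) hsub) ∘ r n := rfl
    simp only
    rw [this, ← MeasurableSpace.comap_comp]
    exact MeasurableSpace.comap_mono (Measurable.comap_le
      (measurable_id.prodMap (Finset.measurable_restrict₂ hsub)))
  · refine sup_le ?_ ?_
    · refine le_trans ?_ (le_iSup _ 0)
      have : (Prod.fst : (ℕ → ℝ) × (ℕ → ℝ) → _) = Prod.fst ∘ r 0 := rfl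
      rw [this, ← MeasurableSpace.comap_comp]
      exact MeasurableSpace.comap_mono (Measurable.comap_le (by fun_prop))
    · rw [MeasurableSpace.pi, MeasurableSpace.comap_iSup]
      refine iSup_le fun k => ?_
      refine le_trans ?_ (le_iSup _ (k + 1))
      rw [MeasurableSpace.comap_comp]
      have hk : k ∈ Finset.range (N + (k + 1)) := Finset.mem_range.2 (by omega)
      have : ((fun b : ℕ → ℝ => b k) ∘ (Prod.snd : (ℕ → ℝ) × (ℕ → ℝ) → _)) =
        (fun q : (ℕ → ℝ) × (Finset.range (N + (k + 1)) → ℝ) => q.2 ⟨k, hk⟩) ∘ r (k + 1) := rfl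
      rw [this, ← MeasurableSpace.comap_comp]
      exact MeasurableSpace.comap_mono (Measurable.comap_le (by fun_prop))
  · have h0 := h (N + n) (by omega)
    rw [← parallelJointLaw_map_restrict] at h0
    refine le_trans (le_of_eq ?_) h0
    have hm : Measurable ((Finset.range (N + n)).restrict : (ℕ → ℝ) → _ → ℝ) := by fun_prop
    have h1 : ((parallelJointLaw v μ).map (r n)).fst = (parallelJointLaw v μ).fst.map id := by
      rw [Measure.fst, Measure.fst, Measure.map_map measurable_fst (hr n),
        Measure.map_map measurable_id measurable_fst]
      rfl
    have h2 : ((parallelJointLaw v μ).map (r n)).snd =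
        (parallelJointLaw v μ).snd.map (Finset.range (N + n)).restrict := by
      rw [Measure.snd, Measure.snd, Measure.map_map measurable_snd (hr n),
        Measure.map_map hm measurable_snd]
      rfl
    rw [mutualInfo, h1, h2, Measure.map_prod_map _ _ measurable_id hm]

/-- Upper bound for the capacity of the vector Gaussian channel, for the water level `w`. -/
lemma parallelCapacity_le {w : ℝ≥0} (hv : ∀ k, v k ≠ 0) (hw : w ≠ 0) {K : ℕ}
    (hK : ∀ k, K ≤ k → w ≤ v k) {S : ℝ}
    (hS : S = ∑ k ∈ Finset.range K, ((w - v k : ℝ≥0) : ℝ)) :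
    parallelCapacity v S ≤
      ENNReal.ofReal (∑ k ∈ Finset.range K, 1 / 2 * Real.log (max w (v k) / v k)) := by
  have hterm : ∀ k, 0 ≤ 1 / 2 * Real.log (max (w : ℝ) (v k) / v k) := fun k => by
    have : (0 : ℝ) < v k := by have := hv k; positivity
    refine mul_nonneg (by norm_num) (Real.log_nonneg ?_)
    rw [le_div_iff₀ this, one_mul]
    exact le_max_right _ _
  have hS0 : 0 ≤ S := hS ▸ Finset.sum_nonneg fun k _ => NNReal.coe_nonneg _
  refine iSup_le fun μ => iSup_le fun hμ => iSup_le fun hE => ?_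
  obtain ⟨hint, hsum⟩ := integral_sq_sum_le μ hS0 hE
  refine mutualInfo_parallelJointLaw_le v μ (Finset.sum_nonneg fun k _ => hterm k) K fun n hn => ?_
  have hw' : ∀ k, (max w (v k)) ≠ 0 := fun k => (lt_max_of_lt_left (pos_iff_ne_zero.2 hw)).ne'
  have hkl := klDiv_restrictedJointLaw v (fun k => max w (v k)) μ (Finset.range n) hv hw'
    fun i _ => hint i
  -- The comparison law is the output law of the water-filling input: variance max(w, v_k) in each
  -- coordinate.
  refine (mutualInfo_le_klDiv_prod _
    (Measure.pi fun i : Finset.range n => gaussianReal 0 (max w (v i)))).trans ?_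
  rw [restrictedJointLaw_fst, hkl]
  refine ENNReal.ofReal_le_ofReal ?_
  rw [Finset.sum_add_distrib]
  have hwpos : (0 : ℝ) < w := by positivity
  have e1 : ∑ k ∈ Finset.range n, 1 / 2 * Real.log (((max w (v k) : ℝ≥0) : ℝ) / v k) =
      ∑ k ∈ Finset.range K, 1 / 2 * Real.log (max (w : ℝ) (v k) / v k) := by
    have hsub := Finset.range_subset_range.2 hn
    rw [← Finset.sum_subset hsub]
    · simp
    · intro k _ hk
      have hk' : w ≤ v k := hK k (by simpa using hk)
      have : (v k : ℝ) ≠ 0 := by have := hv k; positivity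
      rw [max_eq_right hk', div_self this]
      simp
  -- Optimality of water-filling: energy spent in an active subchannel is priced 1/(2w), in an
  -- inactive one 1/(2v_k) ≤ 1/(2w). The budget S is exactly what the active ones absorb.
  have e2 : ∑ k ∈ Finset.range n,
      (∫ f, f k ^ 2 ∂μ + v k - ((max w (v k) : ℝ≥0) : ℝ)) / (2 * ((max w (v k) : ℝ≥0) : ℝ)) ≤ 0 := by
    calc _ ≤ ∑ k ∈ Finset.range n, (∫ f, f k ^ 2 ∂μ - ((w - v k : ℝ≥0) : ℝ)) / (2 * w) := by
          refine Finset.sum_le_sum fun k _ => ?_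
          have hm : 0 ≤ ∫ f, f k ^ 2 ∂μ := integral_nonneg fun f => sq_nonneg _
          rcases le_total w (v k) with h | h
          · rw [max_eq_right h, tsub_eq_zero_of_le h]
            have h' : (w : ℝ) ≤ v k := h
            simp only [add_sub_cancel_right, NNReal.coe_zero, sub_zero]
            gcongr
          · rw [max_eq_left h, NNReal.coe_sub h]
            apply le_of_eq; ring
      _ = ((∑ k ∈ Finset.range n, ∫ f, f k ^ 2 ∂μ) - S) / (2 * w) := by
          rw [← Finset.sum_div, Finset.sum_sub_distrib, hS]
          congr 2
          refine (Finset.sum_subset (Finset.range_subset_range.2 hn) fun k _ hk => ?_).symm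
          rw [tsub_eq_zero_of_le (hK k (by simpa using hk))]; rfl
      _ ≤ 0 := by
          refine div_nonpos_of_nonpos_of_nonneg ?_ (by positivity)
          linarith [hsum (Finset.range n)]
  rw [e1]
  exact add_le_of_nonpos_right e2

lemma restrictedJointLaw_gaussian_snd (s : ℕ → ℝ≥0) :
    (restrictedJointLaw v (Measure.infinitePi fun k => gaussianReal 0 (s k)) I).snd =
      Measure.pi fun i : I => gaussianReal 0 (s i + v i) := by
  have hm : Measurable (I.restrict : (ℕ → ℝ) → I → ℝ) := by fun_prop
  have e : (restrictedJointLaw v (Measure.infinitePi fun k => gaussianReal 0 (s k)) I).snd =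
      ((Measure.pi fun i : I => gaussianReal 0 (s i)).prod
        (Measure.pi fun i : I => gaussianReal 0 (v i))).map fun q => q.1 + q.2 := by
    rw [restrictedJointLaw, Measure.snd, Measure.map_map measurable_snd (by fun_prop),
      ← Measure.infinitePi_map_restrict (fun k => gaussianReal 0 (s k))]
    nth_rw 2 [← Measure.map_id (μ := Measure.pi fun i : I => gaussianReal 0 (v i))]
    rw [Measure.map_prod_map _ _ hm measurable_id, Measure.map_map (by fun_prop) (by fun_prop)]
    rfl
  rw [e, ← (measurePreserving_arrowProdEquivProdArrow ℝ ℝ I (fun i => gaussianReal 0 (s i))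
    (fun i => gaussianReal 0 (v i))).map_eq, Measure.map_map (by fun_prop)
    (MeasurableEquiv.measurable _)]
  have h := Measure.pi_map_pi (μ := fun i : I => (gaussianReal 0 (s i)).prod (gaussianReal 0 (v i)))
    (f := fun (i : I) (z : ℝ × ℝ) => z.1 + z.2) (fun i => by fun_prop)
  refine Eq.trans ?_ (h.trans ?_)
  · rfl
  · congr with i : 1
    have := gaussianReal_conv_gaussianReal (m₁ := 0) (m₂ := 0) (v₁ := s i) (v₂ := v i)
    rw [Measure.conv, add_zero] at this
    exact this

/-- Lower bound for the capacity of the vector Gaussian channel, for the water level `w`. -/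
lemma le_parallelCapacity {w : ℝ≥0} (hv : ∀ k, v k ≠ 0) (hw : w ≠ 0) {K : ℕ}
    (hK : ∀ k, K ≤ k → w ≤ v k) {S : ℝ}
    (hS : S = ∑ k ∈ Finset.range K, ((w - v k : ℝ≥0) : ℝ)) :
    ENNReal.ofReal (∑ k ∈ Finset.range K, 1 / 2 * Real.log (max w (v k) / v k)) ≤
      parallelCapacity v S := by
  -- Truncated subtraction: subchannels noisier than the water level get no power.
  set s : ℕ → ℝ≥0 := fun k => w - v k with hs
  set μ : Measure (ℕ → ℝ) := Measure.infinitePi fun k => gaussianReal 0 (s k) with hμ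
  have hev : ∀ k, μ.map (fun f => f k) = gaussianReal 0 (s k) := fun k =>
    Measure.infinitePi_map_eval _ k
  have hint : ∀ k, Integrable (fun f : ℕ → ℝ => f k ^ 2) μ := fun k => by
    have := integrable_sq_gaussianReal (s k)
    rw [← hev k] at this
    exact this.comp_measurable (by fun_prop)
  have hval : ∀ k, ∫ f, f k ^ 2 ∂μ = s k := fun k => by
    have := integral_sq_gaussianReal (s k)
    rwa [← hev k, integral_map (measurable_pi_apply _).aemeasurable (by fun_prop)] at this
  have hE : ∫⁻ x, ∑' k, ‖x k‖ₑ ^ 2 ∂μ ≤ ENNReal.ofReal S := by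
    rw [lintegral_tsum fun k => ((measurable_pi_apply k).enorm.pow_const 2).aemeasurable]
    have h1 : ∀ k, ∫⁻ f : ℕ → ℝ, ‖f k‖ₑ ^ 2 ∂μ = s k := fun k => by
      rw [← ENNReal.ofReal_coe_nnreal, ← hval k, ofReal_integral_eq_lintegral_ofReal (hint k)
        (ae_of_all _ fun f => sq_nonneg _)]
      refine lintegral_congr fun f => ?_
      rw [Real.enorm_eq_ofReal_abs, ← ENNReal.ofReal_pow (abs_nonneg _), sq_abs]
    simp_rw [h1]
    rw [tsum_eq_sum (s := Finset.range K) fun k hk => by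
      simp only [hs, tsub_eq_zero_of_le (hK k (by simpa using hk)), ENNReal.coe_zero], hS,
      ENNReal.ofReal_sum_of_nonneg fun k _ => NNReal.coe_nonneg _]
    simp only [ENNReal.ofReal_coe_nnreal]
    exact le_rfl
  have hw' : ∀ k, (max w (v k)) ≠ 0 := fun k => (lt_max_of_lt_left (pos_iff_ne_zero.2 hw)).ne'
  have hkl := klDiv_restrictedJointLaw v (fun k => max w (v k)) μ (Finset.range K) hv hw'
    fun i _ => hint i
  have hsv : ∀ k, s k + v k = max w (v k) := fun k => tsub_add_eq_max
  -- Discarding outputs loses information, so finitely many suffice for a lower bound.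
  have hle : mutualInfo (restrictedJointLaw v μ (Finset.range K)) ≤ parallelCapacity v S := by
    rw [← parallelJointLaw_map_restrict]
    refine (mutualInfo_map_prodMap_le _ measurable_id (by fun_prop)).trans ?_
    exact le_iSup_of_le μ (le_iSup_of_le inferInstance (le_iSup_of_le hE le_rfl))
  refine le_trans (le_of_eq ?_) hle
  -- For this input the comparison law is the true output marginal, so the divergence formula is the
  -- mutual information itself.
  rw [mutualInfo, restrictedJointLaw_fst, hμ, restrictedJointLaw_gaussian_snd, ← hμ]
  simp_rw [hsv]
  rw [hkl]
  congr 1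
  refine Finset.sum_congr rfl fun k _ => ?_
  rw [hval]
  have : (s k : ℝ) + v k - ((max w (v k) : ℝ≥0) : ℝ) = 0 := by
    rw [← hsv k]; push_cast; ring
  rw [this]
  simp

/-- The capacity of the vector Gaussian channel is given by water-filling. -/
lemma parallelCapacity_eq {w : ℝ≥0} (hv : ∀ k, v k ≠ 0) (hw : w ≠ 0) {K : ℕ}
    (hK : ∀ k, K ≤ k → w ≤ v k) {S : ℝ}
    (hS : S = ∑ k ∈ Finset.range K, ((w - v k : ℝ≥0) : ℝ)) :
    parallelCapacity v S =
      ENNReal.ofReal (∑ k ∈ Finset.range K, 1 / 2 * Real.log (max w (v k) / v k)) :=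
  le_antisymm (parallelCapacity_le v hv hw hK hS) (le_parallelCapacity v hv hw hK hS)

end Parallel

/-! ### Symmetric triangular operators -/

section Triangular

open Submodule

/-- A symmetric operator that is triangular with respect to a linearly independent total sequence
has an orthonormal basis of eigenvectors. -/
lemma exists_hilbertBasis_of_triangular {E : Type*} [NormedAddCommGroup E] [InnerProductSpace ℝ E]
    [CompleteSpace E] (T : E →ₗ[ℝ] E) (hsymm : ∀ x y, inner ℝ (T x) y = inner ℝ x (T y))
    {e : ℕ → E} (hli : LinearIndependent ℝ e) (htotal : ∀ x, (∀ k, inner ℝ (e k) x = 0) → x = 0)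
    {lam : ℕ → ℝ} (htri : ∀ k, T (e k) - lam k • e k ∈ span ℝ (e '' Set.Iio k)) :
    ∃ b : HilbertBasis ℕ ℝ E, ∀ k, T (b k) = lam k • b k := by
  set g := InnerProductSpace.gramSchmidtNormed ℝ e with hg
  have ho : Orthonormal ℝ g := InnerProductSpace.gramSchmidtNormed_orthonormal hli
  have hspan : ∀ s, span ℝ (g '' s) = span ℝ (InnerProductSpace.gramSchmidt ℝ e '' s) :=
    InnerProductSpace.span_gramSchmidtNormed e
  have hIio : ∀ k, span ℝ (g '' Set.Iio k) = span ℝ (e '' Set.Iio k) := fun k => by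
    rw [hspan, InnerProductSpace.span_gramSchmidt_Iio]
  have hrange : span ℝ (Set.range g) = span ℝ (Set.range e) := by
    rw [InnerProductSpace.span_gramSchmidtNormed_range, InnerProductSpace.span_gramSchmidt]
  have hbot : (span ℝ (Set.range g))ᗮ = ⊥ := by
    rw [hrange, eq_bot_iff]
    intro x hx
    rw [Submodule.mem_bot]
    refine htotal x fun k => ?_
    exact (mem_orthogonal _ _).1 hx _ (subset_span ⟨k, rfl⟩)
  have hT : ∀ k, ∀ y ∈ span ℝ (e '' Set.Iio k), T y ∈ span ℝ (e '' Set.Iio k) := by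
    intro k y hy
    induction hy using span_induction with
    | mem y hy =>
      obtain ⟨j, hj, rfl⟩ := hy
      have h1 := span_mono (R := ℝ) (Set.image_mono (f := e) (Set.Iio_subset_Iio (le_of_lt hj)))
        (htri j)
      have h2 : lam j • e j ∈ span ℝ (e '' Set.Iio k) := smul_mem _ _ (subset_span ⟨j, hj, rfl⟩)
      simpa using add_mem h1 h2
    | zero => simp
    | add x y _ _ hx hy => rw [map_add]; exact add_mem hx hy
    | smul c x _ hx => rw [map_smul]; exact smul_mem _ _ hx
  have hperp : ∀ k, ∀ y ∈ span ℝ (e '' Set.Iio k), inner ℝ (g k) y = 0 := by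
    intro k y hy
    rw [← hIio] at hy
    induction hy using span_induction with
    | mem y hy =>
      obtain ⟨j, hj, rfl⟩ := hy
      exact ho.2 (ne_of_gt hj)
    | zero => simp
    | add x y _ _ hx hy => rw [inner_add_right, hx, hy, add_zero]
    | smul c x _ hx => rw [inner_smul_right, hx, mul_zero]
  have heig : ∀ k, T (g k) = lam k • g k := by
    intro k
    set c : ℝ := ((‖InnerProductSpace.gramSchmidt ℝ e k‖⁻¹ : ℝ)) with hc
    have hgk : g k = c • InnerProductSpace.gramSchmidt ℝ e k := rfl
    have hp : e k - InnerProductSpace.gramSchmidt ℝ e k ∈ span ℝ (e '' Set.Iio k) := by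
      nth_rw 1 [InnerProductSpace.gramSchmidt_def' ℝ e k]
      rw [add_sub_cancel_left]
      refine sum_mem fun i hi => ?_
      rw [← InnerProductSpace.span_gramSchmidt_Iio ℝ e k]
      refine span_mono ?_ (starProjection_apply_mem _ _)
      rintro _ rfl
      exact ⟨i, Finset.mem_Iio.1 hi, rfl⟩
    have hr : T (g k) - lam k • g k ∈ span ℝ (e '' Set.Iio k) := by
      have e1 : T (g k) - lam k • g k = c • (T (e k) - lam k • e k) -
          c • (T (e k - InnerProductSpace.gramSchmidt ℝ e k) -
            lam k • (e k - InnerProductSpace.gramSchmidt ℝ e k)) := by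
        rw [hgk, map_smul, map_sub]
        module
      rw [e1]
      exact sub_mem (smul_mem _ _ (htri k))
        (smul_mem _ _ (sub_mem (hT k _ hp) (smul_mem _ _ hp)))
    -- The defect r = T g_k - λ_k g_k lies in the span of the earlier vectors, and so does T r.
    -- Since g_k is orthogonal to that span, ⟨r, r⟩ = ⟨g_k, T r⟩ - λ_k⟨g_k, r⟩ = 0.
    have h0 : inner ℝ (T (g k) - lam k • g k) (T (g k) - lam k • g k) = 0 := by
      nth_rw 1 [inner_sub_left]
      rw [hsymm, hperp k _ (hT k _ hr), inner_smul_left, hperp k _ hr]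
      simp
    exact sub_eq_zero.1 (inner_self_eq_zero.1 h0)
  refine ⟨HilbertBasis.mkOfOrthogonalEqBot ho hbot, fun k => ?_⟩
  rw [HilbertBasis.coe_mkOfOrthogonalEqBot]
  exact heig k

end Triangular

/-! ### Gaussian integrability and determinacy by moments -/

section Gaussian

lemma integrable_pow_mul_exp_neg_mul_sq {a : ℝ} (ha : 0 < a) (k : ℕ) :
    Integrable fun t : ℝ => t ^ k * Real.exp (-a * t ^ 2) := by
  have := integrable_rpow_mul_exp_neg_mul_sq ha (s := (k : ℝ))
    (by have := k.cast_nonneg (α := ℝ); linarith)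
  simpa using this

lemma memLp_pow_mul_exp_neg_mul_sq {a : ℝ} (ha : 0 < a) (k : ℕ) :
    MemLp (fun t : ℝ => t ^ k * Real.exp (-a * t ^ 2)) 2 := by
  rw [memLp_two_iff_integrable_sq (by fun_prop)]
  refine (integrable_pow_mul_exp_neg_mul_sq (a := 2 * a) (by positivity) (2 * k)).congr
    (ae_of_all _ fun t => ?_)
  simp only
  rw [mul_pow, ← pow_mul, mul_comm k 2, ← Real.exp_nat_mul]
  congr 2
  push_cast; ring

/-- Completing the square, s|t| ≤ (a/2)t² + s²/(2a): half of the Gaussian absorbs the exponential.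
-/
lemma memLp_exp_abs_mul_exp_neg_mul_sq {a : ℝ} (ha : 0 < a) (s : ℝ) :
    MemLp (fun t : ℝ => Real.exp (s * |t|) * Real.exp (-a * t ^ 2)) 2 := by
  have h := (memLp_pow_mul_exp_neg_mul_sq (a := a / 2) (by positivity) 0).const_mul
    (Real.exp (s ^ 2 / (2 * a)))
  refine h.mono (by fun_prop) (ae_of_all _ fun t => ?_)
  rw [← Real.exp_add, pow_zero, one_mul, ← Real.exp_add, Real.norm_eq_abs, Real.norm_eq_abs,
    Real.abs_exp, Real.abs_exp, Real.exp_le_exp]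
  have : 0 ≤ (a * |t| - s) ^ 2 / (2 * a) := by positivity
  have e : (a * |t| - s) ^ 2 / (2 * a) = a / 2 * t ^ 2 - s * |t| + s ^ 2 / (2 * a) := by
    rw [← sq_abs t]; field_simp; ring
  linarith

/-- An integrable function with exponential moments is determined by its moments. -/
lemma ae_eq_zero_of_forall_moment_eq_zero {F : ℝ → ℝ}
    (hF : ∀ s : ℝ, Integrable fun t => Real.exp (s * |t|) * F t)
    (h : ∀ k : ℕ, ∫ t, t ^ k * F t = 0) : F =ᵐ[volume] 0 := by
  have hF0 : Integrable F := by simpa using hF 0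
  -- The Fourier transform vanishes: the power series of the exponential is integrated termwise,
  -- dominated by exp(|s||t|)|F(t)|.
  have hfour : ∀ s : ℝ, ∫ t : ℝ, Complex.exp (s * t * Complex.I) * F t = 0 := by
    intro s
    have hs : HasSum (fun k : ℕ => ∫ t : ℝ, (s * t * Complex.I) ^ k / (k.factorial : ℂ) * F t)
        (∫ t : ℝ, Complex.exp (s * t * Complex.I) * F t) := by
      refine hasSum_integral_of_dominated_convergence
        (fun k t => (|s| * |t|) ^ k / k.factorial * |F t|) (fun k => ?_) (fun k => ?_) ?_ ?_ ?_
      · have := hF0.aestronglyMeasurable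
        have h2 := Complex.continuous_ofReal.comp_aestronglyMeasurable this
        exact (Continuous.aestronglyMeasurable (by fun_prop)).mul h2
      · refine ae_of_all _ fun t => ?_
        simp [mul_pow]
      · refine ae_of_all _ fun t => ?_
        exact (Real.summable_pow_div_factorial _).mul_right _
      · refine ((hF |s|).norm).congr (ae_of_all _ fun t => ?_)
        simp only
        rw [tsum_mul_right, norm_mul, Real.norm_eq_abs, Real.abs_exp, Real.norm_eq_abs]
        congr 1
        rw [Real.exp_eq_exp_ℝ, NormedSpace.exp_eq_tsum_div]
      · refine ae_of_all _ fun t => ?_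
        refine HasSum.mul_right _ ?_
        rw [Complex.exp_eq_exp_ℂ]
        exact NormedSpace.expSeries_div_hasSum_exp _
    have hz : ∀ k : ℕ, ∫ t : ℝ, (s * t * Complex.I) ^ k / (k.factorial : ℂ) * F t = 0 := by
      intro k
      have e : (fun t : ℝ => (s * t * Complex.I) ^ k / (k.factorial : ℂ) * F t) =
          fun t : ℝ => ((s * Complex.I) ^ k / (k.factorial : ℂ)) * ((t ^ k * F t : ℝ) : ℂ) := by
        funext t
        push_cast
        ring
      rw [e, integral_const_mul, integral_complex_ofReal, h k]
      simp
    simp_rw [hz] at hs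
    exact hs.unique hasSum_zero
  have hpm : ∀ G : ℝ → ℝ, Integrable G →
      IsFiniteMeasure (volume.withDensity fun t => ENNReal.ofReal (G t)) := fun G hG =>
    isFiniteMeasure_withDensity_ofReal hG.2
  have := hpm F hF0
  have hn : Integrable fun t => -F t := hF0.neg
  have := hpm (fun t => -F t) hn
  have hcf : ∀ G : ℝ → ℝ, Integrable G → ∀ s,
      charFun (volume.withDensity fun t => ENNReal.ofReal (G t)) s =
        ∫ t : ℝ, Complex.exp (s * t * Complex.I) * (max (G t) 0 : ℝ) := by
    intro G hG s
    rw [charFun_apply_real, integral_withDensity_eq_integral_toReal_smul₀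
      hG.aemeasurable.ennreal_ofReal (ae_of_all _ fun t => ENNReal.ofReal_lt_top)]
    refine integral_congr_ae (ae_of_all _ fun t => ?_)
    simp only [ENNReal.toReal_ofReal', Complex.real_smul]
    rw [mul_comm]
  have hint : ∀ G : ℝ → ℝ, Integrable G → ∀ s : ℝ,
      Integrable fun t : ℝ => Complex.exp (s * t * Complex.I) * (max (G t) 0 : ℝ) := by
    intro G hG s
    refine (hG.pos_part.ofReal (𝕜 := ℂ)).bdd_mul (c := 1)
      (Continuous.aestronglyMeasurable (by fun_prop)) (ae_of_all _ fun t => ?_)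
    rw [← Complex.ofReal_mul, Complex.norm_exp_ofReal_mul_I]
  -- `ENNReal.ofReal` cuts off negative values, so these measures have the positive and negative
  -- parts of `F` as densities; their characteristic functions differ by the Fourier transform of
  -- `F`.
  have heq : (volume.withDensity fun t => ENNReal.ofReal (F t)) =
      volume.withDensity fun t => ENNReal.ofReal (-F t) := by
    refine Measure.ext_of_charFun (funext fun s => ?_)
    rw [hcf F hF0, hcf _ hn, ← sub_eq_zero, ← integral_sub (hint F hF0 s)
      (hint _ hn s), ← hfour s]
    refine integral_congr_ae (ae_of_all _ fun t => ?_)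
    simp only
    rw [← mul_sub, ← Complex.ofReal_sub]
    congr 2
    rcases le_total 0 (F t) with h0 | h0
    · rw [max_eq_left h0, max_eq_right (by linarith)]; ring
    · rw [max_eq_right h0, max_eq_left (by linarith)]; ring
  have hae := (withDensity_eq_iff hF0.aemeasurable.ennreal_ofReal
    hn.aemeasurable.ennreal_ofReal (hF0.lintegral_lt_top.ne)).1 heq
  filter_upwards [hae] with t ht
  simp only [Pi.zero_apply]
  rcases le_total 0 (F t) with h0 | h0
  · rw [ENNReal.ofReal_of_nonpos (p := -F t) (by linarith), ENNReal.ofReal_eq_zero] at ht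
    linarith
  · rw [ENNReal.ofReal_of_nonpos h0, eq_comm, ENNReal.ofReal_eq_zero] at ht
    linarith

end Gaussian

/-! ### Identities between α, β, δ and ρ -/

section Parameters

variable {α β : ℝ}

lemma mul_sinh_delta (h : 1 < α * β) :
    α * β * Real.sinh (delta α β) = Real.cosh (delta α β) := by
  obtain ⟨h0, h1⟩ := delta_spec h
  have hs : 0 < Real.sinh (delta α β) := Real.sinh_pos_iff.2 h0
  rw [← h1, div_mul_cancel₀ _ hs.ne']

lemma rho_mul_cosh_add_sinh (α β : ℝ) :
    rho α β * (Real.cosh (delta α β) + Real.sinh (delta α β)) = 1 := by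
  rw [Real.cosh_add_sinh, rho, ← Real.exp_add]
  simp

lemma rho_pos (α β : ℝ) : 0 < rho α β := Real.exp_pos _

/-- As tanh δ = 1/(αβ), this is β² times tanh² δ + 1/cosh² δ = 1. It makes the kernel of the filter
symmetric. -/
lemma inv_sq_add_sq_div_sq_cosh (hα : 0 < α) (h : 1 < α * β) :
    1 / α ^ 2 + β ^ 2 / Real.cosh (delta α β) ^ 2 = β ^ 2 := by
  have h1 := mul_sinh_delta h
  have h2 := Real.cosh_sq (delta α β)
  have hc := Real.cosh_pos (delta α β)
  set c := Real.cosh (delta α β)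
  set s := Real.sinh (delta α β)
  have e : c ^ 2 + (α * β) ^ 2 = (α * β) ^ 2 * c ^ 2 := by
    have : c ^ 2 = (α * β) ^ 2 * s ^ 2 := by rw [← h1]; ring
    linear_combination this - (α * β) ^ 2 * h2
  field_simp
  nlinarith

/-- Dividing by β² leaves ρ(cosh δ + sinh δ) = 1. It identifies ρ both in the shift of the Gaussian
and in its normalization. -/
lemma rho_mul_cosh_mul (hα : 0 < α) (h : 1 < α * β) :
    rho α β * Real.cosh (delta α β) * (β ^ 2 + β / α) = β ^ 2 := by
  have h1 := mul_sinh_delta h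
  have h3 := rho_mul_cosh_add_sinh α β
  set c := Real.cosh (delta α β)
  set s := Real.sinh (delta α β)
  have : c * (β ^ 2 + β / α) = β ^ 2 * (c + s) := by
    rw [← h1]
    field_simp
  linear_combination β ^ 2 * h3 + rho α β * this

end Parameters

/-! ### The filter as a symmetric operator and its spectrum -/

section Filter

variable {α β : ℝ}

/-- The Gaussian weight occurring in the heat filter. -/
noncomputable def window (α β t t' : ℝ) : ℝ :=
  Real.exp (-(β ^ 2 / 2) * (t / Real.cosh (delta α β) - t') ^ 2)

lemma heatFilter_eq (α β : ℝ) (f : ℝ → ℝ) (t : ℝ) :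
    heatFilter α β f t = Real.exp (-(t ^ 2 / (2 * α ^ 2))) *
      (β / √(2 * Real.pi * Real.cosh (delta α β)) * ∫ t', window α β t t' * f t') := rfl

@[fun_prop]
lemma continuous_window {Z : Type*} [TopologicalSpace Z] {f g : Z → ℝ} (hf : Continuous f)
    (hg : Continuous g) : Continuous fun z => window α β (f z) (g z) := by
  unfold window
  fun_prop

lemma window_nonneg (t t' : ℝ) : 0 ≤ window α β t t' := (Real.exp_pos _).le

/-- The coefficient of t² in the exponent is -(1/α² + β²/cosh² δ)/2 = -β²/2, the same as that of
t'². -/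
lemma exp_mul_window_symm (hα : 0 < α) (hβ : 0 < β) (h : 1 < α * β) (t t' : ℝ) :
    Real.exp (-(t ^ 2 / (2 * α ^ 2))) * window α β t t' =
      Real.exp (-(t' ^ 2 / (2 * α ^ 2))) * window α β t' t := by
  have e := inv_sq_add_sq_div_sq_cosh hα h
  have hc := Real.cosh_pos (delta α β)
  rw [window, window, ← Real.exp_add, ← Real.exp_add]
  congr 1
  set c := Real.cosh (delta α β)
  have e' : ∀ x : ℝ, x ^ 2 / (2 * α ^ 2) = x ^ 2 / 2 * (β ^ 2 - β ^ 2 / c ^ 2) := fun x => by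
    rw [← eq_sub_of_add_eq e]; field_simp
  rw [e', e']
  field_simp
  ring

lemma memLp_window (hβ : 0 < β) (t : ℝ) : MemLp (window α β t) 2 := by
  rw [memLp_two_iff_integrable_sq (by fun_prop)]
  have h := (integrable_exp_neg_mul_sq (b := β ^ 2) (by positivity)).comp_sub_left
    (t / Real.cosh (delta α β))
  refine h.congr (ae_of_all _ fun t' => ?_)
  simp only
  rw [window, ← Real.exp_nat_mul]
  congr 1
  push_cast; ring

lemma integral_window_sq (t : ℝ) :
    ∫ t', window α β t t' ^ 2 = ∫ t', Real.exp (-β ^ 2 * t' ^ 2) := by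
  rw [← integral_sub_left_eq_self (fun t' => Real.exp (-β ^ 2 * t' ^ 2)) volume
    (t / Real.cosh (delta α β))]
  refine integral_congr_ae (ae_of_all _ fun t' => ?_)
  simp only
  rw [window, ← Real.exp_nat_mul]
  congr 1
  push_cast; ring

lemma integrable_window_mul (hβ : 0 < β) {f : ℝ → ℝ} (hf : MemLp f 2) (t : ℝ) :
    Integrable fun t' => window α β t t' * f t' :=
  (memLp_window hβ t).integrable_mul hf

/-- A crude bound by squares. Uniformity in `t` is what matters: with the factor exp(-t²/(2α²)) it
gives square integrability of the output and the hypothesis of Fubini. -/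
lemma integral_window_mul_abs_le (hβ : 0 < β) {f : ℝ → ℝ} (hf : MemLp f 2) (t : ℝ) :
    ∫ t', window α β t t' * |f t'| ≤
      (∫ t', Real.exp (-β ^ 2 * t' ^ 2)) + ∫ t', f t' ^ 2 := by
  rw [← integral_window_sq (α := α) t, ← integral_add (memLp_window hβ t).integrable_sq hf.integrable_sq]
  refine integral_mono (integrable_window_mul hβ hf.abs t)
    ((memLp_window hβ t).integrable_sq.add hf.integrable_sq) fun t' => ?_
  simp only
  rw [← sq_abs (f t')]
  nlinarith [sq_nonneg (window α β t t' - |f t'|), sq_nonneg (window α β t t'), sq_nonneg |f t'|]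

lemma abs_integral_window_mul_le (hβ : 0 < β) {f : ℝ → ℝ} (hf : MemLp f 2) (t : ℝ) :
    |∫ t', window α β t t' * f t'| ≤
      (∫ t', Real.exp (-β ^ 2 * t' ^ 2)) + ∫ t', f t' ^ 2 := by
  refine (abs_integral_le_integral_abs).trans ?_
  refine le_trans (le_of_eq (integral_congr_ae (ae_of_all _ fun t' => ?_)))
    (integral_window_mul_abs_le (α := α) hβ hf t)
  simp only
  rw [abs_mul, abs_of_nonneg (window_nonneg _ _)]

lemma heatFilter_congr {f g : ℝ → ℝ} (h : f =ᵐ[volume] g) : heatFilter α β f = heatFilter α β g := by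
  funext t
  rw [heatFilter_eq, heatFilter_eq]
  congr 2
  refine integral_congr_ae ?_
  filter_upwards [h] with t' ht'
  rw [ht']

lemma memLp_exp_neg_sq_div (hα : 0 < α) :
    MemLp (fun t : ℝ => Real.exp (-(t ^ 2 / (2 * α ^ 2)))) 2 := by
  refine (memLp_congr_ae (ae_of_all _ fun t => ?_)).1
    (memLp_pow_mul_exp_neg_mul_sq (a := 1 / (2 * α ^ 2)) (by positivity) 0)
  simp only [pow_zero, one_mul]
  congr 1
  ring

lemma memLp_heatFilter (hα : 0 < α) (hβ : 0 < β) {f : ℝ → ℝ} (hf : MemLp f 2) :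
    MemLp (heatFilter α β f) 2 := by
  obtain ⟨f', hf', hff'⟩ := hf.1
  rw [heatFilter_congr hff']
  replace hf : MemLp f' 2 := (memLp_congr_ae hff').1 hf
  have hsm : StronglyMeasurable fun t => ∫ t', window α β t t' * f' t' := by
    refine StronglyMeasurable.integral_prod_right (f := fun t t' => window α β t t' * f' t') ?_
    have : Continuous fun p : ℝ × ℝ => window α β p.1 p.2 := by fun_prop
    exact this.stronglyMeasurable.mul (hf'.comp_measurable measurable_snd)
  set M := (∫ t', Real.exp (-β ^ 2 * t' ^ 2)) + ∫ t', f' t' ^ 2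
  set A := β / √(2 * Real.pi * Real.cosh (delta α β))
  refine ((memLp_exp_neg_sq_div hα).const_mul (|A| * M)).mono ?_ (ae_of_all _ fun t => ?_)
  · have : Continuous fun t : ℝ => Real.exp (-(t ^ 2 / (2 * α ^ 2))) := by fun_prop
    exact (this.stronglyMeasurable.mul (hsm.const_mul A)).aestronglyMeasurable
  · rw [heatFilter_eq, Real.norm_eq_abs, Real.norm_eq_abs, abs_mul, abs_mul, abs_mul, abs_mul,
      abs_abs, Real.abs_exp]
    have h1 := abs_integral_window_mul_le (α := α) hβ hf t
    calc _ ≤ Real.exp (-(t ^ 2 / (2 * α ^ 2))) * (|A| * M) := by gcongr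
      _ ≤ Real.exp (-(t ^ 2 / (2 * α ^ 2))) * (|A| * |M|) := by gcongr; exact le_abs_self _
      _ = _ := by ring

/-- The heat filter as an operator on signals. -/
noncomputable def heatOperator (hα : 0 < α) (hβ : 0 < β) : Signal →ₗ[ℝ] Signal where
  toFun f := (memLp_heatFilter hα hβ (Lp.memLp f)).toLp
  map_add' f g := by
    rw [← MemLp.toLp_add]
    refine MemLp.toLp_congr _ _ (ae_of_all _ fun t => ?_)
    rw [heatFilter_congr (Lp.coeFn_add f g), Pi.add_apply, heatFilter_eq, heatFilter_eq,
      heatFilter_eq]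
    simp only [Pi.add_apply, mul_add]
    rw [integral_add (integrable_window_mul hβ (Lp.memLp f) t)
      (integrable_window_mul hβ (Lp.memLp g) t)]
    ring
  map_smul' c f := by
    rw [RingHom.id_apply, ← MemLp.toLp_const_smul]
    refine MemLp.toLp_congr _ _ (ae_of_all _ fun t => ?_)
    rw [heatFilter_congr (Lp.coeFn_smul c f), Pi.smul_apply, heatFilter_eq, heatFilter_eq]
    simp only [Pi.smul_apply, smul_eq_mul, mul_left_comm _ c]
    rw [integral_const_mul]
    ring

lemma coeFn_heatOperator (hα : 0 < α) (hβ : 0 < β) (f : Signal) :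
    heatOperator hα hβ f =ᵐ[volume] heatFilter α β f :=
  (memLp_heatFilter hα hβ (Lp.memLp f)).coeFn_toLp

lemma inner_heatOperator (hα : 0 < α) (hβ : 0 < β) (f φ : Signal) :
    inner ℝ (heatOperator hα hβ f) φ = ∫ t, heatFilter α β f t * φ t := by
  rw [L2.inner_def]
  refine integral_congr_ae ?_
  filter_upwards [coeFn_heatOperator hα hβ f] with t ht
  rw [ht]
  simp [mul_comm]

lemma heatOperator_symm (hα : 0 < α) (hβ : 0 < β) (h : 1 < α * β) (f φ : Signal) :
    inner ℝ (heatOperator hα hβ f) φ = inner ℝ f (heatOperator hα hβ φ) := by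
  rw [real_inner_comm _ f, inner_heatOperator, inner_heatOperator]
  set A := β / √(2 * Real.pi * Real.cosh (delta α β))
  have hf := Lp.memLp f
  have hφ := Lp.memLp φ
  have hfm := (Lp.stronglyMeasurable f)
  have hφm := (Lp.stronglyMeasurable φ)
  have hint : Integrable (Function.uncurry fun t t' : ℝ =>
      Real.exp (-(t ^ 2 / (2 * α ^ 2))) * φ t * (window α β t t' * f t')) (volume.prod volume) := by
    have hsm : StronglyMeasurable (Function.uncurry fun t t' : ℝ =>
        Real.exp (-(t ^ 2 / (2 * α ^ 2))) * φ t * (window α β t t' * f t')) := by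
      have c1 : Continuous fun p : ℝ × ℝ => window α β p.1 p.2 := by fun_prop
      have c2 : Continuous fun p : ℝ × ℝ => Real.exp (-(p.1 ^ 2 / (2 * α ^ 2))) := by fun_prop
      exact (c2.stronglyMeasurable.mul (hφm.comp_measurable measurable_fst)).mul
        (c1.stronglyMeasurable.mul (hfm.comp_measurable measurable_snd))
    have hg : Integrable fun t : ℝ => Real.exp (-(t ^ 2 / (2 * α ^ 2))) * φ t :=
      (memLp_exp_neg_sq_div hα).integrable_mul hφ
    rw [integrable_prod_iff hsm.aestronglyMeasurable]
    refine ⟨ae_of_all _ fun t => (integrable_window_mul hβ hf t).const_mul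
      (Real.exp (-(t ^ 2 / (2 * α ^ 2))) * φ t), ?_⟩
    refine (hg.norm.mul_const
      ((∫ t', Real.exp (-β ^ 2 * t' ^ 2)) + ∫ t', f t' ^ 2)).mono
      hsm.norm.integral_prod_right.aestronglyMeasurable (ae_of_all _ fun t => ?_)
    have e : ∫ t', ‖Function.uncurry (fun t t' : ℝ =>
        Real.exp (-(t ^ 2 / (2 * α ^ 2))) * φ t * (window α β t t' * f t')) (t, t')‖ =
        ‖Real.exp (-(t ^ 2 / (2 * α ^ 2))) * φ t‖ * ∫ t', window α β t t' * |f t'| := by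
      rw [← integral_const_mul]
      refine integral_congr_ae (ae_of_all _ fun t' => ?_)
      simp only [Function.uncurry_apply_pair]
      rw [norm_mul, norm_mul (window α β t t'), Real.norm_of_nonneg (window_nonneg t t'),
        Real.norm_eq_abs (f t')]
    rw [e]
    simp only [norm_mul, norm_norm]
    gcongr
    have h0 : 0 ≤ ∫ t', window α β t t' * |f t'| :=
      integral_nonneg fun t' => mul_nonneg (window_nonneg _ _) (abs_nonneg _)
    rw [Real.norm_of_nonneg h0]
    exact (integral_window_mul_abs_le hβ hf t).trans (le_abs_self _)
  have hsw := integral_integral_swap hint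
  have e1 : ∫ t, heatFilter α β f t * φ t = A * ∫ t, ∫ t',
      Real.exp (-(t ^ 2 / (2 * α ^ 2))) * φ t * (window α β t t' * f t') := by
    rw [← integral_const_mul]
    refine integral_congr_ae (ae_of_all _ fun t => ?_)
    simp only
    rw [heatFilter_eq, integral_const_mul]
    ring
  have e2 : ∫ t, heatFilter α β φ t * f t = A * ∫ t', ∫ t,
      Real.exp (-(t ^ 2 / (2 * α ^ 2))) * φ t * (window α β t t' * f t') := by
    rw [← integral_const_mul]
    refine integral_congr_ae (ae_of_all _ fun t' => ?_)
    simp only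
    have : ∀ t, Real.exp (-(t ^ 2 / (2 * α ^ 2))) * φ t * (window α β t t' * f t') =
        (Real.exp (-(t' ^ 2 / (2 * α ^ 2))) * f t') * (window α β t' t * φ t) := fun t => by
      linear_combination φ t * f t' * exp_mul_window_symm hα hβ h t t'
    simp_rw [this]
    rw [heatFilter_eq, integral_const_mul]
    ring
  rw [e1, e2, hsw]

/-- The products of monomials with the Gaussian ground state of the heat filter. -/
noncomputable def gaussianMonomial (hα : 0 < α) (hβ : 0 < β) (k : ℕ) : Signal :=
  (memLp_pow_mul_exp_neg_mul_sq (a := β / (2 * α)) (by positivity) k).toLp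

lemma coeFn_gaussianMonomial (hα : 0 < α) (hβ : 0 < β) (k : ℕ) :
    gaussianMonomial hα hβ k =ᵐ[volume] fun t => t ^ k * Real.exp (-(β / (2 * α)) * t ^ 2) :=
  MemLp.coeFn_toLp _

/-- The kernel times the ground state is, in t', a Gaussian of precision D = β² + β/α centred at ρt.
Expanding (u + ρt)^k gives a polynomial in t with leading coefficient ρ^k times the Gaussian mass,
which is √ρ. -/
lemma heatFilter_gaussianMonomial (hα : 0 < α) (hβ : 0 < β) (h : 1 < α * β) (k : ℕ) :
    ∃ c : ℕ → ℝ, c k = rho α β ^ k * √(rho α β) ∧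
      ∀ t, heatFilter α β (fun t => t ^ k * Real.exp (-(β / (2 * α)) * t ^ 2)) t =
        ∑ j ∈ Finset.range (k + 1), c j * (t ^ j * Real.exp (-(β / (2 * α)) * t ^ 2)) := by
  set A := β / √(2 * Real.pi * Real.cosh (delta α β)) with hA
  set D := β ^ 2 + β / α with hD
  have hDpos : 0 < D := by positivity
  have hc := Real.cosh_pos (delta α β)
  have hr := rho_pos α β
  have hsq := inv_sq_add_sq_div_sq_cosh hα h
  have hrD : rho α β * Real.cosh (delta α β) * D = β ^ 2 := rho_mul_cosh_mul hα h
  set r := rho α β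
  set ch := Real.cosh (delta α β) with hch
  let m : ℕ → ℝ := fun i => ∫ u : ℝ, u ^ i * Real.exp (-(D / 2) * u ^ 2)
  refine ⟨fun j => A * (r ^ j * m (k - j) * k.choose j), ?_, fun t => ?_⟩
  · have hm0 : m 0 = √(2 * Real.pi / D) := by
      simp only [m, pow_zero, one_mul]
      rw [integral_gaussian]
      congr 1
      field_simp
    simp only [Nat.sub_self, Nat.choose_self, hm0, Nat.cast_one, mul_one]
    have : A * √(2 * Real.pi / D) = √r := by
      have hr' : r = β ^ 2 / (ch * D) := by
        rw [eq_div_iff (by positivity)]; linarith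
      rw [hA, hr', Real.sqrt_div (by positivity), Real.sqrt_div (by positivity),
        Real.sqrt_mul (by positivity), Real.sqrt_mul hc.le, Real.sqrt_sq hβ.le]
      have h2 : √(2 * Real.pi) ≠ 0 := by positivity
      field_simp
    linear_combination r ^ k * this
  · rw [heatFilter_eq]
    have e : ∀ t', window α β t t' * (t' ^ k * Real.exp (-(β / (2 * α)) * t' ^ 2)) =
        Real.exp (t ^ 2 / (2 * α ^ 2)) * Real.exp (-(β / (2 * α)) * t ^ 2) *
          ((t' - r * t + r * t) ^ k * Real.exp (-(D / 2) * (t' - r * t) ^ 2)) := by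
      intro t'
      rw [window, sub_add_cancel]
      have : Real.exp (-(β ^ 2 / 2) * (t / ch - t') ^ 2) * Real.exp (-(β / (2 * α)) * t' ^ 2) =
          Real.exp (t ^ 2 / (2 * α ^ 2)) * Real.exp (-(β / (2 * α)) * t ^ 2) *
            Real.exp (-(D / 2) * (t' - r * t) ^ 2) := by
        rw [← Real.exp_add, ← Real.exp_add, ← Real.exp_add]
        congr 1
        have h1 : D * r = β ^ 2 / ch := by rw [eq_div_iff hc.ne']; linarith
        have h2 : D * r ^ 2 = 1 / α ^ 2 + β ^ 2 / ch ^ 2 - β / α := by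
          -- After multiplication by D both sides equal β²(β² - 1/α²), since (β² + β/α)(β² - β/α) =
          -- β⁴ - β²/α².
          have h4 : D * (D * r ^ 2) = D * (1 / α ^ 2 + β ^ 2 / ch ^ 2 - β / α) := by
            have : D * (D * r ^ 2) = β ^ 2 * (β ^ 2 / ch ^ 2) := by
              calc D * (D * r ^ 2) = (D * r) ^ 2 := by ring
                _ = _ := by rw [h1]; ring
            rw [this, hsq, eq_sub_of_add_eq' hsq, hD]
            field_simp
            ring
          exact mul_left_cancel₀ hDpos.ne' h4
        have h3 : -(D / 2) * (t' - r * t) ^ 2 =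
            -(D / 2) * t' ^ 2 + (D * r) * t * t' - (D * r ^ 2) * t ^ 2 / 2 := by ring
        rw [h3, h1, h2, hD]
        field_simp
        ring
      linear_combination t' ^ k * this
    simp_rw [e]
    rw [integral_const_mul, integral_sub_right_eq_self
      (fun u => (u + r * t) ^ k * Real.exp (-(D / 2) * u ^ 2)) (r * t)]
    have e2 : ∫ u : ℝ, (u + r * t) ^ k * Real.exp (-(D / 2) * u ^ 2) =
        ∑ j ∈ Finset.range (k + 1), (r * t) ^ j * m (k - j) * k.choose j := by
      have : ∀ u : ℝ, (u + r * t) ^ k * Real.exp (-(D / 2) * u ^ 2) =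
          ∑ j ∈ Finset.range (k + 1), ((r * t) ^ j * k.choose j) *
            (u ^ (k - j) * Real.exp (-(D / 2) * u ^ 2)) := by
        intro u
        rw [add_comm, add_pow, Finset.sum_mul]
        exact Finset.sum_congr rfl fun j _ => by ring
      simp_rw [this]
      rw [integral_finsetSum _ fun j _ =>
        (integrable_pow_mul_exp_neg_mul_sq (by positivity) (k - j)).const_mul _]
      refine Finset.sum_congr rfl fun j _ => ?_
      rw [integral_const_mul]
      ring
    rw [e2]
    have e3 : Real.exp (-(t ^ 2 / (2 * α ^ 2))) * Real.exp (t ^ 2 / (2 * α ^ 2)) = 1 := by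
      rw [← Real.exp_add]; simp
    calc _ = (Real.exp (-(t ^ 2 / (2 * α ^ 2))) * Real.exp (t ^ 2 / (2 * α ^ 2))) *
          (A * Real.exp (-(β / (2 * α)) * t ^ 2)) *
            ∑ j ∈ Finset.range (k + 1), (r * t) ^ j * m (k - j) * k.choose j := by ring
      _ = _ := by
        rw [e3, one_mul, Finset.mul_sum]
        exact Finset.sum_congr rfl fun j _ => by rw [mul_pow]; ring

lemma heatOperator_gaussianMonomial (hα : 0 < α) (hβ : 0 < β) (h : 1 < α * β) (k : ℕ) :
    heatOperator hα hβ (gaussianMonomial hα hβ k) -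
      (rho α β ^ k * √(rho α β)) • gaussianMonomial hα hβ k ∈
        Submodule.span ℝ (gaussianMonomial hα hβ '' Set.Iio k) := by
  obtain ⟨c, hck, hc⟩ := heatFilter_gaussianMonomial hα hβ h k
  have e : heatOperator hα hβ (gaussianMonomial hα hβ k) =
      ∑ j ∈ Finset.range (k + 1), c j • gaussianMonomial hα hβ j := by
    refine Lp.ext ?_
    refine (coeFn_heatOperator hα hβ _).trans ?_
    rw [heatFilter_congr (coeFn_gaussianMonomial hα hβ k)]
    have h1 : ∀ᵐ t : ℝ, ∀ j : ℕ, (gaussianMonomial hα hβ j : ℝ → ℝ) t =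
        t ^ j * Real.exp (-(β / (2 * α)) * t ^ 2) :=
      ae_all_iff.2 fun j => coeFn_gaussianMonomial hα hβ j
    have h2 : ∀ᵐ t : ℝ, ∀ j : ℕ, (c j • gaussianMonomial hα hβ j : Signal) t =
        c j * (gaussianMonomial hα hβ j : ℝ → ℝ) t :=
      ae_all_iff.2 fun j => Lp.coeFn_smul _ _
    filter_upwards [h1, h2, Lp.coeFn_finsetSum (Finset.range (k + 1)) fun j => c j • gaussianMonomial hα hβ j]
      with t h1 h2 h3
    rw [h3, hc, Finset.sum_apply]
    exact Finset.sum_congr rfl fun j _ => by rw [h2, h1]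
  rw [e, Finset.sum_range_succ, hck, add_sub_cancel_right]
  exact Submodule.sum_mem _ fun j hj => Submodule.smul_mem _ _
    (Submodule.subset_span ⟨j, Finset.mem_range.1 hj, rfl⟩)

/-- Dividing out the Gaussian leaves a polynomial vanishing almost everywhere, hence by continuity
everywhere. -/
lemma linearIndependent_gaussianMonomial (hα : 0 < α) (hβ : 0 < β) :
    LinearIndependent ℝ (gaussianMonomial hα hβ) := by
  rw [linearIndependent_iff']
  intro s g hg
  have h1 : ∀ᵐ t : ℝ, ∀ j : ℕ, (gaussianMonomial hα hβ j : ℝ → ℝ) t =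
      t ^ j * Real.exp (-(β / (2 * α)) * t ^ 2) :=
    ae_all_iff.2 fun j => coeFn_gaussianMonomial hα hβ j
  have h2 : ∀ᵐ t : ℝ, ∀ j : ℕ, (g j • gaussianMonomial hα hβ j : Signal) t =
      g j * (gaussianMonomial hα hβ j : ℝ → ℝ) t :=
    ae_all_iff.2 fun j => Lp.coeFn_smul _ _
  set p : Polynomial ℝ := ∑ j ∈ s, Polynomial.monomial j (g j) with hp
  have hae : (fun t => p.eval t) =ᵐ[volume] fun _ => (0 : ℝ) := by
    have h4 : ∀ᵐ t : ℝ, (∑ j ∈ s, g j • gaussianMonomial hα hβ j : Signal) t = 0 := by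
      rw [hg]
      exact Lp.coeFn_zero _ _ _
    filter_upwards [h1, h2, Lp.coeFn_finsetSum s fun j => g j • gaussianMonomial hα hβ j, h4]
      with t h1 h2 h3 h4
    rw [h3, Finset.sum_apply] at h4
    have h5 : p.eval t * Real.exp (-(β / (2 * α)) * t ^ 2) = 0 := by
      rw [← h4, hp, Polynomial.eval_finsetSum, Finset.sum_mul]
      exact Finset.sum_congr rfl fun j _ => by rw [h2, h1, Polynomial.eval_monomial]; ring
    exact (mul_eq_zero.1 h5).resolve_right (Real.exp_pos _).ne'
  have hz : p = 0 := by
    refine Polynomial.funext fun t => ?_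
    have := (Continuous.ae_eq_iff_eq volume (by fun_prop) continuous_const).1 hae
    rw [congrFun this t, Polynomial.eval_zero]
  intro i hi
  have := congrArg (fun q => Polynomial.coeff q i) hz
  simpa [hp, Polynomial.finsetSum_coeff, Polynomial.coeff_monomial, hi] using this

/-- The inner products are the moments of x times the Gaussian, which has exponential moments of
every order. -/
lemma eq_zero_of_inner_gaussianMonomial (hα : 0 < α) (hβ : 0 < β) (x : Signal)
    (hx : ∀ k, inner ℝ (gaussianMonomial hα hβ k) x = 0) : x = 0 := by
  have hb : 0 < β / (2 * α) := by positivity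
  have hF := ae_eq_zero_of_forall_moment_eq_zero
    (F := fun t => Real.exp (-(β / (2 * α)) * t ^ 2) * x t) (fun s => ?_) fun k => ?_
  · refine Lp.ext ?_
    filter_upwards [hF, Lp.coeFn_zero ℝ 2 volume] with t ht h0
    rw [h0]
    exact (mul_eq_zero.1 ht).resolve_left (Real.exp_pos _).ne'
  · refine ((memLp_exp_abs_mul_exp_neg_mul_sq hb s).integrable_mul (Lp.memLp x)).congr
      (ae_of_all _ fun t => ?_)
    simp only [Pi.mul_apply]
    ring
  · rw [← hx k, L2.inner_def]
    refine integral_congr_ae ?_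
    filter_upwards [coeFn_gaussianMonomial hα hβ k] with t ht
    rw [ht]
    simp only [RCLike.inner_apply, conj_trivial]
    ring

/-- The heat filter is diagonal in an orthonormal basis, with eigenvalues `ρ ^ (k + 1/2)`. -/
lemma exists_hilbertBasis_heatOperator (hα : 0 < α) (hβ : 0 < β) (h : 1 < α * β) :
    ∃ b : HilbertBasis ℕ ℝ Signal,
      ∀ k, heatOperator hα hβ (b k) = (rho α β ^ k * √(rho α β)) • b k :=
  exists_hilbertBasis_of_triangular _ (heatOperator_symm hα hβ h)
    (linearIndependent_gaussianMonomial hα hβ) (eq_zero_of_inner_gaussianMonomial hα hβ)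
    (heatOperator_gaussianMonomial hα hβ h)

end Filter

/-! ### White noise in an orthonormal basis -/

section WhiteNoise

variable {Ω : Type*} [MeasurableSpace Ω] {P : Measure Ω} {n : Signal → Ω → ℝ} {N : ℝ}

lemma IsWhiteNoise.memLp (hn : IsWhiteNoise P n N) (φ : Signal) : MemLp (n φ) 2 P :=
  (hn.gaussian.hasGaussianLaw_eval φ).memLp_two

/-- The coordinates of white noise in an orthonormal sequence are independent and identically
distributed. -/
lemma IsWhiteNoise.map_orthonormal (hn : IsWhiteNoise P n N) {b : ℕ → Signal}
    (hb : Orthonormal ℝ b) :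
    P.map (fun ω k => n (b k) ω) = Measure.infinitePi fun _ => gaussianReal 0 N.toNNReal := by
  have hP : IsProbabilityMeasure P := hn.gaussian.isProbabilityMeasure
  have hind : iIndepFun (fun k => n (b k)) P := by
    rw [iIndepFun_iff_finset]
    intro s
    have hg := (hn.gaussian.comp_right b).hasGaussianLaw s
    refine HasGaussianLaw.iIndepFun_of_covariance_eq_zero (X := fun i : s => n (b i)) hg
      fun i j hij => ?_
    rw [covariance_eq_sub (hn.memLp _) (hn.memLp _), hn.mean_zero, zero_mul, sub_zero]
    have := hn.covariance (b i) (b j)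
    rw [hb.2 fun h => hij (Subtype.ext h), mul_zero] at this
    exact this
  rw [hind.map_fun_eq_infinitePi_map fun k => hn.measurable _]
  congr with k : 1
  rw [(hn.gaussian.hasGaussianLaw_eval (b k)).map_eq_gaussianReal, hn.mean_zero,
    variance_of_integral_eq_zero (hn.measurable _).aemeasurable (hn.mean_zero _)]
  have := hn.covariance (b k) (b k)
  rw [real_inner_self_eq_norm_sq, hb.1 k] at this
  simp_rw [pow_two, this]
  simp

/-- `J` need not be linear. White noise is not assumed linear in its test function; its covariance
alone forces this identity. -/
lemma norm_sub_sum_sq_of_inner_eq {E F : Type*} [NormedAddCommGroup E] [InnerProductSpace ℝ E]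
    [NormedAddCommGroup F] [InnerProductSpace ℝ F] {J : E → F} {c : ℝ}
    (hJ : ∀ x y, inner ℝ (J x) (J y) = c * inner ℝ x y) (x : E) (b : ℕ → E) (a : ℕ → ℝ)
    (s : Finset ℕ) :
    ‖J x - ∑ k ∈ s, a k • J (b k)‖ ^ 2 = c * ‖x - ∑ k ∈ s, a k • b k‖ ^ 2 := by
  rw [← real_inner_self_eq_norm_sq, ← real_inner_self_eq_norm_sq]
  simp only [inner_sub_left, inner_sub_right, sum_inner, inner_sum, inner_smul_left,
    inner_smul_right, hJ, conj_trivial, mul_sub, Finset.mul_sum]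
  have e' : ∀ i t, a i * (c * t) = c * (a i * t) := fun i t => by ring
  simp only [e']

/-- White noise is almost surely determined by its coordinates in an orthonormal basis. -/
lemma IsWhiteNoise.exists_subseq_tendsto (hn : IsWhiteNoise P n N) (b : HilbertBasis ℕ ℝ Signal)
    (φ : Signal) : ∃ ns : ℕ → ℕ, StrictMono ns ∧ ∀ᵐ ω ∂P,
      Tendsto (fun i => ∑ k ∈ Finset.range (ns i), inner ℝ (b k) φ * n (b k) ω) atTop
        (𝓝 (n φ ω)) := by
  -- Up to the factor N, `J` is isometric, so basis expansions converge in L²(P) and, along a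
  -- subsequence depending on φ, almost surely.
  let J : Signal → Lp ℝ 2 P := fun ψ => (hn.memLp ψ).toLp
  have hJ : ∀ x y, inner ℝ (J x) (J y) = N * inner ℝ x y := by
    intro x y
    rw [L2.inner_def, ← hn.covariance x y]
    refine integral_congr_ae ?_
    filter_upwards [(hn.memLp x).coeFn_toLp, (hn.memLp y).coeFn_toLp] with ω h1 h2
    rw [h1, h2]
    simp [mul_comm]
  set a : ℕ → ℝ := fun k => inner ℝ (b k) φ
  have h1 : Tendsto (fun m => ∑ k ∈ Finset.range m, a k • b k) atTop (𝓝 φ) := by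
    have := (b.hasSum_repr φ).tendsto_sum_nat
    simpa only [b.repr_apply_apply] using this
  have h2 : Tendsto (fun m => ∑ k ∈ Finset.range m, a k • J (b k)) atTop (𝓝 (J φ)) := by
    rw [tendsto_iff_norm_sub_tendsto_zero] at h1 ⊢
    have h3 : Tendsto (fun m => √(N * ‖∑ k ∈ Finset.range m, a k • b k - φ‖ ^ 2)) atTop (𝓝 0) := by
      have := (((h1.pow 2).const_mul N).sqrt)
      simpa using this
    refine h3.congr fun m => ?_
    rw [norm_sub_rev, ← norm_sub_sum_sq_of_inner_eq hJ, norm_sub_rev, Real.sqrt_sq (norm_nonneg _)]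
  obtain ⟨ns, hns, hlim⟩ := (tendstoInMeasure_of_tendsto_Lp h2).exists_seq_tendsto_ae
  refine ⟨ns, hns, ?_⟩
  have e1 : ∀ᵐ ω ∂P, ∀ k, (a k • J (b k) : Lp ℝ 2 P) ω = a k * n (b k) ω := by
    refine ae_all_iff.2 fun k => ?_
    filter_upwards [Lp.coeFn_smul (a k) (J (b k)), (hn.memLp (b k)).coeFn_toLp] with ω h1 h2
    rw [h1, Pi.smul_apply, h2, smul_eq_mul]
  have e2 : ∀ᵐ ω ∂P, ∀ m : ℕ, (∑ k ∈ Finset.range m, a k • J (b k) : Lp ℝ 2 P) ω =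
      (∑ k ∈ Finset.range m, ⇑(a k • J (b k))) ω :=
    ae_all_iff.2 fun m => Lp.coeFn_finsetSum (Finset.range m) fun k => a k • J (b k)
  filter_upwards [hlim, e1, e2, (hn.memLp φ).coeFn_toLp] with ω h e1 e2 h4
  rw [h4] at h
  refine h.congr fun i => ?_
  rw [e2, Finset.sum_apply]
  exact Finset.sum_congr rfl fun k _ => e1 k

end WhiteNoise

/-! ### Equivalence of the heat channel and the vector channel -/

section Equivalence

lemma enorm_sq_eq_tsum (b : HilbertBasis ℕ ℝ Signal) (f : Signal) :
    ‖f‖ₑ ^ 2 = ∑' k, ‖inner ℝ (b k) f‖ₑ ^ 2 := by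
  have h := b.hasSum_inner_mul_inner f f
  rw [real_inner_self_eq_norm_sq] at h
  have e : ∀ x : ℝ, ‖x‖ₑ ^ 2 = ENNReal.ofReal (x ^ 2) := fun x => by
    rw [Real.enorm_eq_ofReal_abs, ← ENNReal.ofReal_pow (abs_nonneg _), sq_abs]
  have h' : HasSum (fun k => inner ℝ (b k) f ^ 2) (‖f‖ ^ 2) := by
    have e2 : (fun k => inner ℝ (b k) f ^ 2) = fun k => inner ℝ f (b k) * inner ℝ (b k) f :=
      funext fun k => by rw [real_inner_comm, pow_two]
    rw [e2]
    exact h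
  simp_rw [e]
  rw [← ENNReal.ofReal_tsum_of_nonneg (fun k => sq_nonneg _) h'.summable, h'.tsum_eq,
    ENNReal.ofReal_pow (norm_nonneg _), ofReal_norm]

/-- The coordinates of a signal in an orthonormal basis. -/
noncomputable def coords (b : HilbertBasis ℕ ℝ Signal) (f : Signal) (k : ℕ) : ℝ := inner ℝ (b k) f

@[fun_prop]
lemma measurable_coords (b : HilbertBasis ℕ ℝ Signal) : Measurable (coords b) :=
  measurable_pi_lambda _ fun k => (by unfold coords; fun_prop : Continuous fun f => coords b f k).measurable

/-- By Lusin-Souslin, the injective Borel map `coords b` between Polish spaces is a measurable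
embedding, so its inverse extends measurably; by Riesz-Fischer its range contains every
square-summable sequence. -/
lemma exists_measurable_leftInverse_coords (b : HilbertBasis ℕ ℝ Signal) :
    ∃ G : (ℕ → ℝ) → Signal, Measurable G ∧ (∀ f, G (coords b f) = f) ∧
      ∀ x : ℕ → ℝ, ∑' k, ‖x k‖ₑ ^ 2 ≠ ∞ → coords b (G x) = x := by
  have hinj : Function.Injective (coords b) := by
    intro f g h
    refine b.repr.injective (Subtype.ext (funext fun k => ?_))
    rw [b.repr_apply_apply, b.repr_apply_apply]
    exact congrFun h k
  have : Fact ((2 : ℝ≥0∞) ≠ ∞) := ⟨by simp⟩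
  have : PolishSpace Signal := inferInstance
  have hemb : MeasurableEmbedding (coords b) := (measurable_coords b).measurableEmbedding hinj
  obtain ⟨G, hG, hGc⟩ := hemb.exists_measurable_extend measurable_id fun _ => ⟨0⟩
  have hGc' : ∀ f, G (coords b f) = f := fun f => congrFun hGc f
  refine ⟨G, hG, hGc', fun x hx => ?_⟩
  have hmem : Memℓp x 2 := by
    refine memℓp_gen ?_
    have e : ∀ k, ‖x k‖ₑ ^ 2 = ENNReal.ofReal (x k ^ 2) := fun k => by
      rw [Real.enorm_eq_ofReal_abs, ← ENNReal.ofReal_pow (abs_nonneg _), sq_abs]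
    simp_rw [e] at hx
    have := ENNReal.summable_toReal hx
    simpa [ENNReal.toReal_ofReal, sq_nonneg] using this
  have : coords b (b.repr.symm ⟨x, hmem⟩) = x := by
    funext k
    rw [coords, ← b.repr_apply_apply, LinearIsometryEquiv.apply_symm_apply]
  rw [← this, hGc']

variable {Ω : Type*} [MeasurableSpace Ω] {P : Measure Ω} {n : Signal → Ω → ℝ} {N α β : ℝ}

/-- Moving the operator to the test function makes each observation a continuous functional of the
input, with no appeal to boundedness of the operator. -/
lemma jointLaw_eq (hα : 0 < α) (hβ : 0 < β) (h : 1 < α * β) (μ : Measure Signal) :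
    jointLaw P n α β μ = (μ.prod P).map fun q : Signal × Ω =>
      (q.1, fun φ : Signal => inner ℝ q.1 (heatOperator hα hβ φ) + n φ q.2) := by
  rw [jointLaw]
  congr with q φ
  · rfl
  · simp only
    rw [← inner_heatOperator hα hβ, heatOperator_symm hα hβ h]

lemma measurable_channel (hn : IsWhiteNoise P n N) (hα : 0 < α) (hβ : 0 < β) :
    Measurable fun q : Signal × Ω =>
      (q.1, fun φ : Signal => inner ℝ q.1 (heatOperator hα hβ φ) + n φ q.2) := by
  refine measurable_fst.prodMk (measurable_pi_lambda _ fun φ => ?_)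
  have h1 : Continuous fun f : Signal => inner ℝ f (heatOperator hα hβ φ) := by fun_prop
  exact (h1.measurable.comp measurable_fst).add ((hn.measurable φ).comp measurable_snd)

/-- Passing to coordinates in an eigenbasis does not change the mutual information. -/
lemma mutualInfo_jointLaw [IsProbabilityMeasure P] (hn : IsWhiteNoise P n N) (hα : 0 < α)
    (hβ : 0 < β) (h : 1 < α * β) (b : HilbertBasis ℕ ℝ Signal) {lam : ℕ → ℝ}
    (hlam : ∀ k, 0 < lam k) (hb : ∀ k, heatOperator hα hβ (b k) = lam k • b k) {v : ℕ → ℝ≥0}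
    (hv : ∀ k, (v k : ℝ) = N / lam k ^ 2) (μ : Measure Signal) [IsProbabilityMeasure μ] :
    mutualInfo (jointLaw P n α β μ) = mutualInfo (parallelJointLaw v (μ.map (coords b))) := by
  have hU := measurable_coords b
  have hprob : IsProbabilityMeasure (μ.map (coords b)) :=
    Measure.isProbabilityMeasure_map hU.aemeasurable
  have hch := measurable_channel hn hα hβ
  have hjp : IsProbabilityMeasure (jointLaw P n α β μ) := by
    rw [jointLaw_eq hα hβ h]
    exact Measure.isProbabilityMeasure_map hch.aemeasurable
  obtain ⟨G, hG, hGU, -⟩ := exists_measurable_leftInverse_coords b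
  let W : Ω → ℕ → ℝ := fun ω k => n (b k) ω / lam k
  have hW : Measurable W := measurable_pi_lambda _ fun k => (hn.measurable _).div_const _
  have hWlaw : P.map W = Measure.infinitePi fun k => gaussianReal 0 (v k) := by
    have h1 := Measure.infinitePi_map_pi (μ := fun _ : ℕ => gaussianReal 0 N.toNNReal)
      (f := fun k (x : ℝ) => x / lam k) fun k => by fun_prop
    rw [← hn.map_orthonormal b.orthonormal, Measure.map_map (by fun_prop)
      (measurable_pi_lambda _ fun k => hn.measurable _)] at h1
    refine h1.trans ?_
    congr with k : 1
    rw [gaussianReal_map_div_const, zero_div]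
    congr 1
    rw [← NNReal.coe_inj, hv k]
    have hN : 0 ≤ N := by
      by_contra hneg
      push Not at hneg
      have h2 : N / lam k ^ 2 < 0 := div_neg_of_neg_of_pos hneg (pow_pos (hlam k) 2)
      rw [← hv k] at h2
      exact absurd h2 (not_lt.2 (v k).2)
    simp [Real.coe_toNNReal _ hN]
  have hpar : parallelJointLaw v (μ.map (coords b)) =
      (μ.prod P).map fun q => (coords b q.1, coords b q.1 + W q.2) := by
    rw [parallelJointLaw, ← hWlaw, Measure.map_prod_map _ _ hU hW,
      Measure.map_map (by fun_prop) (hU.prodMap hW)]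
    rfl
  have hcoef : ∀ (f : Signal) k, inner ℝ f (heatOperator hα hβ (b k)) = lam k * coords b f k := by
    intro f k
    rw [hb, inner_smul_right, real_inner_comm, coords]
  refine le_antisymm ?_ ?_
  · choose ns hns hlim using hn.exists_subseq_tendsto b
    -- Rebuilds the whole output from its coordinates. A limsup is measurable in `y` whether or not
    -- the sums converge; almost surely it is the limit.
    let R : (ℕ → ℝ) → Signal → ℝ := fun y φ =>
      limsup (fun i => ∑ k ∈ Finset.range (ns φ i), inner ℝ (b k) φ * (lam k * y k)) atTop
    have hR : Measurable R := by
      refine measurable_pi_lambda _ fun φ => ?_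
      exact Measurable.limsup fun i => by fun_prop
    have key : (parallelJointLaw v (μ.map (coords b))).map (Prod.map G R) = jointLaw P n α β μ := by
      have hmR : Measurable fun q : Signal × Ω => R (coords b q.1 + W q.2) :=
        hR.comp ((hU.comp measurable_fst).add (hW.comp measurable_snd))
      rw [hpar, Measure.map_map (hG.prodMap hR) (by fun_prop), jointLaw_eq hα hβ h]
      -- The exceptional null set depends on φ, and there are uncountably many φ. Equality of laws
      -- on the product σ-algebra still follows from almost sure equality at each index; the input
      -- joins the family through its coordinates and is recovered by `G`.
      let X : ℕ ⊕ Signal → Signal × Ω → ℝ := fun i q =>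
        Sum.elim (coords b q.1) (R (coords b q.1 + W q.2)) i
      let Y : ℕ ⊕ Signal → Signal × Ω → ℝ := fun i q =>
        Sum.elim (coords b q.1) (fun φ => inner ℝ q.1 (heatOperator hα hβ φ) + n φ q.2) i
      have hX : Measurable fun q i => X i q := by
        refine measurable_pi_lambda _ fun i => ?_
        cases i with
        | inl k => exact (measurable_pi_apply k).comp (hU.comp measurable_fst)
        | inr φ => exact (measurable_pi_apply φ).comp hmR
      have hY : Measurable fun q i => Y i q := by
        refine measurable_pi_lambda _ fun i => ?_
        cases i with
        | inl k => exact (measurable_pi_apply k).comp (hU.comp measurable_fst)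
        | inr φ => exact (measurable_pi_apply φ).comp (measurable_snd.comp hch)
      have hXY : ∀ i, X i =ᵐ[μ.prod P] Y i := by
        intro i
        cases i with
        | inl k => rfl
        | inr φ =>
          filter_upwards [Measure.quasiMeasurePreserving_snd.ae (hlim φ)] with q hq
          simp only [X, Y, Sum.elim_inr, R]
          refine Tendsto.limsup_eq ?_
          have h1 := (b.hasSum_inner_mul_inner (heatOperator hα hβ q.1) φ).tendsto_sum_nat.comp
            (hns φ).tendsto_atTop
          rw [heatOperator_symm hα hβ h] at h1
          refine (h1.add hq).congr fun i => ?_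
          simp only [Function.comp_apply]
          rw [← Finset.sum_add_distrib]
          refine Finset.sum_congr rfl fun k _ => ?_
          rw [heatOperator_symm hα hβ h, hcoef]
          simp only [Pi.add_apply, W]
          field_simp [(hlam k).ne']
      have heq := map_eq_of_forall_ae_eq hX.aemeasurable hY.aemeasurable hXY
      have hH : Measurable fun z : ℕ ⊕ Signal → ℝ => (G fun k => z (.inl k), fun φ => z (.inr φ)) :=
        (hG.comp (by fun_prop)).prodMk (by fun_prop)
      have heq2 := congrArg (Measure.map
        fun z : ℕ ⊕ Signal → ℝ => (G fun k => z (.inl k), fun φ => z (.inr φ))) heq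
      rw [Measure.map_map hH hX, Measure.map_map hH hY] at heq2
      refine Eq.trans ?_ (heq2.trans ?_)
      · rfl
      · congr with q φ
        · simp only [Function.comp_apply, Y, Sum.elim_inl]
          rw [show (fun k => coords b q.1 k) = coords b q.1 from rfl, hGU]
        · rfl
    rw [← key]
    exact mutualInfo_map_prodMap_le _ hG hR
  -- Conversely, the vector channel is read off by testing the output against the eigenvectors and
  -- rescaling.
  · have hO : Measurable fun (y : Signal → ℝ) (k : ℕ) => y (b k) / lam k := by fun_prop
    have key : (jointLaw P n α β μ).map (Prod.map (coords b) fun y k => y (b k) / lam k) =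
        parallelJointLaw v (μ.map (coords b)) := by
      rw [hpar, jointLaw_eq hα hβ h, Measure.map_map (hU.prodMap hO) hch]
      congr with q k
      · rfl
      · simp only [Function.comp_apply, Prod.map_apply, Pi.add_apply, W]
        rw [hcoef]
        field_simp [(hlam k).ne']
    rw [← key]
    exact mutualInfo_map_prodMap_le _ hU hO

/-- By Parseval, coordinates preserve energy. An admissible law on sequences has finite mean energy,
so it is carried by ℓ² and comes from a law on signals. -/
lemma capacity_eq_parallelCapacity_of_hilbertBasis [IsProbabilityMeasure P]
    (hn : IsWhiteNoise P n N) (hα : 0 < α)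
    (hβ : 0 < β) (h : 1 < α * β) (b : HilbertBasis ℕ ℝ Signal) {lam : ℕ → ℝ}
    (hlam : ∀ k, 0 < lam k) (hb : ∀ k, heatOperator hα hβ (b k) = lam k • b k) {v : ℕ → ℝ≥0}
    (hv : ∀ k, (v k : ℝ) = N / lam k ^ 2) (S : ℝ) :
    capacity P n α β S = parallelCapacity v S := by
  have hU := measurable_coords b
  have hen : ∀ f : Signal, ∑' k, ‖coords b f k‖ₑ ^ 2 = ‖f‖ₑ ^ 2 := fun f =>
    (enorm_sq_eq_tsum b f).symm
  have hmeas : Measurable fun x : ℕ → ℝ => ∑' k, ‖x k‖ₑ ^ 2 :=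
    Measurable.tsum fun k => (measurable_pi_apply k).enorm.pow_const 2
  refine le_antisymm ?_ ?_
  · refine iSup_le fun μ => iSup_le fun hμ => iSup_le fun hE => ?_
    have hprob : IsProbabilityMeasure (μ.map (coords b)) :=
      Measure.isProbabilityMeasure_map hU.aemeasurable
    rw [mutualInfo_jointLaw hn hα hβ h b hlam hb hv]
    refine le_iSup_of_le (μ.map (coords b)) (le_iSup_of_le hprob (le_iSup_of_le ?_ le_rfl))
    rw [lintegral_map hmeas hU]
    simpa only [hen] using hE
  · refine iSup_le fun ν => iSup_le fun hν => iSup_le fun hE => ?_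
    obtain ⟨G, hG, hGU, hUG⟩ := exists_measurable_leftInverse_coords b
    have hprob : IsProbabilityMeasure (ν.map G) := Measure.isProbabilityMeasure_map hG.aemeasurable
    have hfin : ∀ᵐ x ∂ν, coords b (G x) = x := by
      have := ae_lt_top hmeas (hE.trans_lt ENNReal.ofReal_lt_top).ne
      filter_upwards [this] with x hx
      exact hUG x hx.ne
    have hback : (ν.map G).map (coords b) = ν := by
      rw [Measure.map_map hU hG]
      refine (Measure.map_congr (g := id) ?_).trans Measure.map_id
      filter_upwards [hfin] with x hx
      exact hx
    have hmi := mutualInfo_jointLaw hn hα hβ h b hlam hb hv (ν.map G)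
    rw [hback] at hmi
    rw [← hmi]
    refine le_iSup_of_le (ν.map G) (le_iSup_of_le hprob (le_iSup_of_le ?_ le_rfl))
    refine le_trans (le_of_eq ?_) hE
    rw [lintegral_map (by fun_prop) hG]
    refine lintegral_congr_ae ?_
    filter_upwards [hfin] with x hx
    rw [← hen, hx]

lemma coe_subchannelVar (θ α β : ℝ) (k : ℕ) :
    (subchannelVar θ α β k : ℝ) = θ ^ 2 / (rho α β ^ k * √(rho α β)) ^ 2 := by
  have hr := rho_pos α β
  rw [subchannelVar, Real.coe_toNNReal _ (by positivity), mul_pow, Real.sq_sqrt hr.le,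
    div_eq_mul_inv]
  congr 1
  rw [← pow_mul, ← pow_succ, ← zpow_natCast, ← zpow_neg]
  congr 1
  push_cast
  ring

/-- The heat channel is equivalent to the vector Gaussian channel of its subchannels. -/
lemma capacity_eq_parallelCapacity [IsProbabilityMeasure P] {θ : ℝ}
    (hn : IsWhiteNoise P n (θ ^ 2)) (hα : 0 < α) (hβ : 0 < β) (h : 1 < α * β) (S : ℝ) :
    capacity P n α β S = parallelCapacity (subchannelVar θ α β) S := by
  obtain ⟨b, hb⟩ := exists_hilbertBasis_heatOperator hα hβ h
  have hr := rho_pos α β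
  exact capacity_eq_parallelCapacity_of_hilbertBasis hn hα hβ h b (fun k => by positivity) hb
    (coe_subchannelVar θ α β) S

end Equivalence

/-! ### The time-frequency integrals in closed form -/

section Radial

lemma integral_comp_div_prod {α β : ℝ} (hα : 0 < α) (hβ : 0 < β) (F : ℝ × ℝ → ℝ) :
    ∫ p : ℝ × ℝ, F (p.1 / α, p.2 / β) = α * β * ∫ p, F p := by
  have hmap : ∀ a : ℝ, 0 < a → (volume : Measure ℝ).map (fun x => x / a) =
      ENNReal.ofReal a • volume := fun a ha => by
    have := Real.map_volume_mul_right (a := a⁻¹) (by positivity)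
    rw [inv_inv, abs_of_pos ha] at this
    simpa only [div_eq_mul_inv] using this
  have hpm : (volume : Measure (ℝ × ℝ)).map (Prod.map (fun x => x / α) fun x => x / β) =
      ENNReal.ofReal (α * β) • volume := by
    rw [Measure.volume_eq_prod, ← Measure.map_prod_map _ _ (by fun_prop) (by fun_prop), hmap α hα,
      hmap β hβ, Measure.prod_smul_left, Measure.prod_smul_right, smul_smul,
      ENNReal.ofReal_mul hα.le]
  have hemb : MeasurableEmbedding (Prod.map (fun x : ℝ => x / α) fun x : ℝ => x / β) :=
    ((Homeomorph.mulRight₀ α⁻¹ (inv_ne_zero hα.ne')).prodCongr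
      (Homeomorph.mulRight₀ β⁻¹ (inv_ne_zero hβ.ne'))).measurableEmbedding
  have h := hemb.integral_map (μ := volume) F
  rw [hpm, integral_smul_measure, ENNReal.toReal_ofReal (by positivity)] at h
  exact h.symm

lemma integral_radial (g : ℝ → ℝ) :
    ∫ p : ℝ × ℝ, g (p.1 ^ 2 + p.2 ^ 2) = 2 * Real.pi * ∫ r in Set.Ioi (0 : ℝ), r * g (r ^ 2) := by
  rw [← integral_comp_polarCoord_symm]
  have e : ∀ p : ℝ × ℝ, p.1 • g ((polarCoord.symm p).1 ^ 2 + (polarCoord.symm p).2 ^ 2) =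
      (p.1 * g (p.1 ^ 2)) * (fun _ => (1 : ℝ)) p.2 := by
    intro p
    rw [polarCoord_symm_apply, smul_eq_mul, mul_one]
    congr 2
    linear_combination p.1 ^ 2 * Real.cos_sq_add_sin_sq p.2
  simp_rw [e]
  rw [polarCoord_target, Measure.volume_eq_prod,
    setIntegral_prod_mul (fun r => r * g (r ^ 2)) (fun _ => (1 : ℝ))]
  simp only [integral_const, MeasurableSet.univ, measureReal_restrict_apply, Set.univ_inter,
    Real.volume_real_Ioo, smul_eq_mul, mul_one]
  rw [max_eq_left (by linarith [Real.pi_pos])]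
  ring

lemma integral_Ioi_eq_of_eventually_zero {h : ℝ → ℝ} {R : ℝ} (hR : 0 ≤ R)
    (hz : ∀ r, R < r → h r = 0) : ∫ r in Set.Ioi (0 : ℝ), h r = ∫ r in (0 : ℝ)..R, h r := by
  rw [intervalIntegral.integral_of_le hR]
  refine (setIntegral_eq_of_subset_of_forall_sdiff_eq_zero measurableSet_Ioi
    Set.Ioc_subset_Ioi_self fun r hr => hz r ?_)
  by_contra hle
  exact hr.2 ⟨hr.1, not_lt.1 hle⟩

lemma integral_mul_max_sub_exp {a : ℝ} (ha : 1 ≤ a) :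
    ∫ r in Set.Ioi (0 : ℝ), r * max 0 (a - Real.exp (r ^ 2)) = (a * Real.log a - a + 1) / 2 := by
  have hL : 0 ≤ Real.log a := Real.log_nonneg ha
  have h0 : 0 < a := by linarith
  rw [integral_Ioi_eq_of_eventually_zero (Real.sqrt_nonneg (Real.log a)) fun r hr => ?_]
  · have e : ∀ r ∈ Set.uIcc 0 √(Real.log a), r * max 0 (a - Real.exp (r ^ 2)) =
        r * (a - Real.exp (r ^ 2)) := fun r hr => by
      rw [Set.uIcc_of_le (Real.sqrt_nonneg _)] at hr
      have : r ^ 2 ≤ Real.log a := (Real.le_sqrt hr.1 hL).1 hr.2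
      rw [max_eq_right]
      have := (Real.le_log_iff_exp_le h0).1 this
      linarith
    rw [intervalIntegral.integral_congr e]
    have hd : ∀ r ∈ Set.uIcc 0 √(Real.log a), HasDerivAt
        (fun r => a * r ^ 2 / 2 - Real.exp (r ^ 2) / 2) (r * (a - Real.exp (r ^ 2))) r := by
      intro r _
      have h1 : HasDerivAt (fun r : ℝ => r ^ 2) (2 * r) r := by simpa using hasDerivAt_pow 2 r
      have h2 := ((h1.const_mul a).div_const 2).sub (h1.exp.div_const 2)
      refine h2.congr_deriv ?_
      ring
    rw [intervalIntegral.integral_eq_sub_of_hasDerivAt hd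
      (Continuous.intervalIntegrable (by fun_prop) _ _), Real.sq_sqrt hL, Real.exp_log h0]
    simp
    ring
  · have : Real.log a < r ^ 2 := Real.lt_sq_of_sqrt_lt hr
    have := (Real.log_lt_iff_lt_exp h0).1 this
    rw [max_eq_left (by linarith), mul_zero]

lemma integral_mul_max_sub_sq {L : ℝ} (hL : 0 ≤ L) :
    ∫ r in Set.Ioi (0 : ℝ), r * max 0 (L - r ^ 2) = L ^ 2 / 4 := by
  rw [integral_Ioi_eq_of_eventually_zero (Real.sqrt_nonneg L) fun r hr => ?_]
  · have e : ∀ r ∈ Set.uIcc 0 √L, r * max 0 (L - r ^ 2) = r * (L - r ^ 2) := fun r hr => by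
      rw [Set.uIcc_of_le (Real.sqrt_nonneg _)] at hr
      have : r ^ 2 ≤ L := (Real.le_sqrt hr.1 hL).1 hr.2
      rw [max_eq_right (by linarith)]
    rw [intervalIntegral.integral_congr e]
    have hd : ∀ r ∈ Set.uIcc 0 √L, HasDerivAt
        (fun r => L * r ^ 2 / 2 - r ^ 4 / 4) (r * (L - r ^ 2)) r := by
      intro r _
      have h1 : HasDerivAt (fun r : ℝ => r ^ 2) (2 * r) r := by simpa using hasDerivAt_pow 2 r
      have h3 : HasDerivAt (fun r : ℝ => r ^ 4) (4 * r ^ 3) r := by simpa using hasDerivAt_pow 4 r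
      have h2 := ((h1.const_mul L).div_const 2).sub (h3.div_const 4)
      refine h2.congr_deriv ?_
      ring
    rw [intervalIntegral.integral_eq_sub_of_hasDerivAt hd
      (Continuous.intervalIntegrable (by fun_prop) _ _)]
    have : √L ^ 4 = L ^ 2 := by
      rw [show √L ^ 4 = (√L ^ 2) ^ 2 by ring, Real.sq_sqrt hL]
    rw [Real.sq_sqrt hL, this]
    simp
    ring
  · have : L < r ^ 2 := Real.lt_sq_of_sqrt_lt hr
    rw [max_eq_left (by linarith), mul_zero]

variable {θ α β : ℝ}

/-- The coefficient of `exp (t ^ 2 / α ^ 2 + ω ^ 2 / β ^ 2)` in the noise `N(t, ω)`. -/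
noncomputable def noiseFloor (θ α β : ℝ) : ℝ := θ ^ 2 / (2 * Real.pi) * Real.cosh (delta α β)

lemma noiseFloor_pos (hθ : 0 < θ) (α β : ℝ) : 0 < noiseFloor θ α β := by
  have := Real.cosh_pos (delta α β)
  have := Real.pi_pos
  unfold noiseFloor
  positivity

lemma noiseTF_eq (θ α β t ω : ℝ) :
    noiseTF θ α β t ω = noiseFloor θ α β * Real.exp ((t / α) ^ 2 + (ω / β) ^ 2) := by
  rw [noiseTF, noiseFloor, div_pow, div_pow]

/-- Scaling by α, β and polar coordinates reduce this to the integral of r(a - exp(r²))⁺. A level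
below the noise floor gives zero, just as a = 1 does; hence the maximum. -/
lemma energyIntegral_eq (hθ : 0 < θ) (hα : 0 < α) (hβ : 0 < β) (ν : ℝ) :
    energyIntegral θ α β ν = Real.pi * (α * β) * noiseFloor θ α β *
      (max 1 (ν / noiseFloor θ α β) * Real.log (max 1 (ν / noiseFloor θ α β)) -
        max 1 (ν / noiseFloor θ α β) + 1) := by
  have hc := noiseFloor_pos hθ α β
  set c := noiseFloor θ α β
  have e : ∀ u : ℝ, 0 ≤ u → max 0 (ν - c * Real.exp u) =
      c * max 0 (max 1 (ν / c) - Real.exp u) := by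
    intro u hu
    have h1 : 1 ≤ Real.exp u := Real.one_le_exp hu
    rcases le_total (ν / c) 1 with h | h
    · have h2 : ν - c * Real.exp u ≤ 0 := by
        have := (div_le_one hc).1 h
        nlinarith
      rw [max_eq_left h, max_eq_left h2, max_eq_left (sub_nonpos.2 h1), mul_zero]
    · rw [max_eq_right h, mul_max_of_nonneg _ _ hc.le, mul_zero, mul_sub, mul_div_cancel₀ _ hc.ne']
  have h2 := integral_comp_div_prod hα hβ fun p => max 0 (ν - c * Real.exp (p.1 ^ 2 + p.2 ^ 2))
  simp only at h2
  rw [energyIntegral]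
  simp_rw [noiseTF_eq]
  rw [h2, integral_radial fun u => max 0 (ν - c * Real.exp u)]
  have h3 : ∀ r : ℝ, r * max 0 (ν - c * Real.exp (r ^ 2)) =
      c * (r * max 0 (max 1 (ν / c) - Real.exp (r ^ 2))) := fun r => by
    rw [e _ (sq_nonneg r)]; ring
  simp_rw [h3]
  rw [integral_const_mul, integral_mul_max_sub_exp (le_max_left _ _)]
  ring

/-- Here 1 + (ν - N)⁺/N = max(1, ν/N), so the logarithm is (ln a - r²)⁺ in scaled polar coordinates.
-/
lemma capacityIntegral_eq (hθ : 0 < θ) (hα : 0 < α) (hβ : 0 < β) (ν : ℝ) :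
    capacityIntegral θ α β ν =
      α * β * (Real.log (max 1 (ν / noiseFloor θ α β)) ^ 2 / 8) := by
  have hc := noiseFloor_pos hθ α β
  set c := noiseFloor θ α β
  have hm : 0 < max 1 (ν / c) := lt_max_of_lt_left one_pos
  have hL : 0 ≤ Real.log (max 1 (ν / c)) := Real.log_nonneg (le_max_left _ _)
  have e : ∀ u : ℝ, 0 ≤ u → Real.log (1 + max 0 (ν - c * Real.exp u) / (c * Real.exp u)) =
      max 0 (Real.log (max 1 (ν / c)) - u) := by
    intro u hu
    have hu' : 0 < c * Real.exp u := by positivity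
    rcases le_total ν (c * Real.exp u) with h | h
    · rw [max_eq_left (by linarith), zero_div, add_zero, Real.log_one, max_eq_left]
      rw [sub_nonpos, Real.log_le_iff_le_exp hm]
      refine max_le (Real.one_le_exp hu) ?_
      rw [div_le_iff₀ hc]; linarith
    · have h4 : Real.exp u ≤ ν / c := by rw [le_div_iff₀ hc]; linarith
      have h5 : 1 ≤ ν / c := (Real.one_le_exp hu).trans h4
      have hν : 0 < ν / c := by linarith
      have h6 : 1 + (ν - c * Real.exp u) / (c * Real.exp u) = (ν / c) / Real.exp u := by
        field_simp
        ring
      rw [max_eq_right (by linarith), max_eq_right h5, h6, Real.log_div hν.ne' (Real.exp_pos _).ne',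
        Real.log_exp, max_eq_right]
      rw [sub_nonneg, Real.le_log_iff_exp_le hν]
      exact h4
  have h2 := integral_comp_div_prod hα hβ fun p => 1 / 2 * Real.log
    (1 + max 0 (ν - c * Real.exp (p.1 ^ 2 + p.2 ^ 2)) / (c * Real.exp (p.1 ^ 2 + p.2 ^ 2)))
  simp only at h2
  rw [capacityIntegral]
  simp_rw [noiseTF_eq]
  rw [h2, integral_radial fun u => 1 / 2 * Real.log
    (1 + max 0 (ν - c * Real.exp u) / (c * Real.exp u))]
  have h3 : ∀ r : ℝ, r * (1 / 2 * Real.log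
      (1 + max 0 (ν - c * Real.exp (r ^ 2)) / (c * Real.exp (r ^ 2)))) =
      1 / 2 * (r * max 0 (Real.log (max 1 (ν / c)) - r ^ 2)) := fun r => by
    rw [e _ (sq_nonneg r)]; ring
  simp_rw [h3]
  rw [integral_const_mul, integral_mul_max_sub_sq hL]
  have := Real.pi_pos
  field_simp
  ring

end Radial

/-! ### Midpoint sums for energy and capacity -/

section RiemannSum

/-- The midpoint rule for a decreasing function. -/
lemma abs_midpoint_sum_sub_integral_le {g : ℝ → ℝ} (hg : Antitone g) {U : ℝ}
    (hz : ∀ u, U ≤ u → g u = 0) {d : ℝ} (hd : 0 < d) {K : ℕ}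
    (hK : U ≤ d * (2 * K - 1)) :
    |2 * d * ∑ k ∈ Finset.range K, g (d * (2 * k + 1)) - ∫ u in (0 : ℝ)..U, g u| ≤ d * g (-d) := by
  have hint : ∀ a b, IntervalIntegrable g volume a b := fun a b => hg.intervalIntegrable
  set f : ℝ → ℝ := fun x => g (2 * d * x) with hf
  have hfa : Antitone f := fun x y hxy => hg (by gcongr)
  have htail : ∀ b, U ≤ b → ∫ u in U..b, g u = 0 := fun b hb => by
    rw [intervalIntegral.integral_congr (g := fun _ => 0) fun u hu => ?_]
    · simp
    · rw [Set.uIcc_of_le hb] at hu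
      exact hz u hu.1
  have hbd : ∀ a b, a ≤ b → ∫ u in a..b, g u ≤ (b - a) * g a := fun a b hab => by
    calc ∫ u in a..b, g u ≤ ∫ _ in a..b, g a :=
          intervalIntegral.integral_mono_on hab (hint a b) (by simp) fun u hu => hg hu.1
      _ = _ := by simp
  have hsum1 : ∑ i ∈ Finset.range K, f (-(1 / 2) + ((i + 1 : ℕ) : ℝ)) =
      ∑ k ∈ Finset.range K, g (d * (2 * k + 1)) :=
    Finset.sum_congr rfl fun i _ => by simp only [hf]; congr 1; push_cast; ring
  have hsum2 : ∑ i ∈ Finset.range K, f (1 / 2 + (i : ℝ)) =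
      ∑ k ∈ Finset.range K, g (d * (2 * k + 1)) :=
    Finset.sum_congr rfl fun i _ => by simp only [hf]; congr 1; ring
  -- Shifting by half a cell traps the sum between the integrals of `g` over [d, d(2K+1)] and [-d,
  -- d(2K-1)]. Both reach the zero tail, and at the lower end each differs from the integral over
  -- [0, U] by at most d·g(-d).
  have up := (hfa.antitoneOn (Set.Icc (-(1 / 2) : ℝ) (-(1 / 2) + K))).sum_le_integral
  have lo := (hfa.antitoneOn (Set.Icc (1 / 2 : ℝ) (1 / 2 + K))).integral_le_sum
  rw [hsum1] at up
  rw [hsum2] at lo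
  have hcv : ∀ a b, 2 * d * ∫ x in a..b, f x = ∫ u in 2 * d * a..2 * d * b, g u := fun a b =>
    intervalIntegral.mul_integral_comp_mul_left (f := g) (2 * d)
  have up' := mul_le_mul_of_nonneg_left up (by positivity : 0 ≤ 2 * d)
  have lo' := mul_le_mul_of_nonneg_left lo (by positivity : 0 ≤ 2 * d)
  rw [hcv] at up' lo'
  rw [show 2 * d * -(1 / 2) = -d by ring,
    show 2 * d * (-(1 / 2) + (K : ℝ)) = d * (2 * K - 1) by ring,
    ← intervalIntegral.integral_add_adjacent_intervals (hint (-d) 0) (hint 0 _),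
    ← intervalIntegral.integral_add_adjacent_intervals (hint 0 U) (hint U _), htail _ hK] at up'
  have hK' : U ≤ d * (2 * K + 1) := by nlinarith
  rw [show 2 * d * (1 / 2) = d by ring,
    show 2 * d * (1 / 2 + (K : ℝ)) = d * (2 * K + 1) by ring,
    ← intervalIntegral.integral_interval_sub_left (hint 0 _) (hint 0 d),
    ← intervalIntegral.integral_add_adjacent_intervals (hint 0 U) (hint U _), htail _ hK'] at lo'
  have b1 := hbd (-d) 0 (by linarith)
  have b2 := hbd 0 d hd.le
  have b3 : g 0 ≤ g (-d) := hg (by linarith)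
  rw [abs_le]
  constructor
  · nlinarith
  · nlinarith

lemma abs_sum_max_sub_exp_le {a d : ℝ} (ha : 1 ≤ a) (hd : 0 < d) {K : ℕ}
    (hK : Real.log a ≤ d * (2 * K - 1)) :
    |2 * d * ∑ k ∈ Finset.range K, max 0 (a - Real.exp (d * (2 * k + 1))) -
      (a * Real.log a - a + 1)| ≤ d * a := by
  have h0 : 0 < a := by linarith
  have hL : 0 ≤ Real.log a := Real.log_nonneg ha
  have hg : Antitone fun u => max 0 (a - Real.exp u) := fun u v huv =>
    max_le_max le_rfl (sub_le_sub_left (Real.exp_le_exp.2 huv) a)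
  have h := abs_midpoint_sum_sub_integral_le hg (fun u hu => by
    have := (Real.log_le_iff_le_exp h0).1 hu
    exact max_eq_left (by linarith)) hd hK
  have e : ∫ u in (0 : ℝ)..Real.log a, max 0 (a - Real.exp u) = a * Real.log a - a + 1 := by
    rw [intervalIntegral.integral_congr (g := fun u => a - Real.exp u) fun u hu => ?_]
    · rw [intervalIntegral.integral_sub (by simp) (Continuous.intervalIntegrable (by fun_prop) _ _),
        integral_exp, Real.exp_log h0]
      simp
      ring
    · rw [Set.uIcc_of_le hL] at hu
      have := (Real.le_log_iff_exp_le h0).1 hu.2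
      exact max_eq_right (by linarith)
  rw [e] at h
  refine h.trans ?_
  gcongr
  exact max_le h0.le (by linarith [Real.exp_pos (-d)])

lemma abs_sum_max_sub_le {L d : ℝ} (hL : 0 ≤ L) (hd : 0 < d) {K : ℕ}
    (hK : L ≤ d * (2 * K - 1)) :
    |2 * d * ∑ k ∈ Finset.range K, max 0 (L - d * (2 * k + 1)) - L ^ 2 / 2| ≤ d * (L + d) := by
  have hg : Antitone fun u => max 0 (L - u) := fun u v huv =>
    max_le_max le_rfl (sub_le_sub_left huv L)
  have h := abs_midpoint_sum_sub_integral_le hg (fun u hu =>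
    max_eq_left (by linarith)) hd hK
  have e : ∫ u in (0 : ℝ)..L, max 0 (L - u) = L ^ 2 / 2 := by
    rw [intervalIntegral.integral_congr (g := fun u => L - u) fun u hu => ?_]
    · rw [intervalIntegral.integral_sub (by simp) (by simp), integral_id]
      simp
      ring
    · rw [Set.uIcc_of_le hL] at hu
      exact max_eq_right (by linarith [hu.2])
  rw [e] at h
  refine h.trans (le_of_eq ?_)
  rw [sub_neg_eq_add, max_eq_right (by linarith)]

/-- Put a = e^L: the derivative in L of a ln a - a + 1 is L e^L, which dominates that of L²/2 for L
≥ 0. The bound does not degenerate at a = 1. -/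
lemma sq_sub_sq_le_entropy {a b : ℝ} (ha : 1 ≤ a) (hb : 1 ≤ b) :
    |Real.log a ^ 2 - Real.log b ^ 2| ≤
      2 * |(a * Real.log a - a + 1) - (b * Real.log b - b + 1)| := by
  have hmono : MonotoneOn (fun L : ℝ => Real.exp L * L - Real.exp L - L ^ 2 / 2) (Set.Ici 0) := by
    have hd : ∀ L : ℝ, HasDerivAt (fun L : ℝ => Real.exp L * L - Real.exp L - L ^ 2 / 2)
        (L * (Real.exp L - 1)) L := fun L => by
      have h1 : HasDerivAt (fun r : ℝ => r ^ 2) (2 * L) L := by simpa using hasDerivAt_pow 2 L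
      have h2 := (((Real.hasDerivAt_exp L).mul (hasDerivAt_id L)).sub
        (Real.hasDerivAt_exp L)).sub (h1.div_const 2)
      refine h2.congr_deriv ?_
      simp
      ring
    refine monotoneOn_of_deriv_nonneg (convex_Ici 0) (by fun_prop)
      (fun L _ => (hd L).differentiableAt.differentiableWithinAt) fun L hL => ?_
    rw [(hd L).deriv]
    rw [interior_Ici] at hL
    have hL' : 0 < L := hL
    exact mul_nonneg hL'.le (by linarith [Real.one_le_exp hL'.le])
  have key : ∀ {a b : ℝ}, 1 ≤ a → a ≤ b → Real.log b ^ 2 - Real.log a ^ 2 ≤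
      2 * ((b * Real.log b - b + 1) - (a * Real.log a - a + 1)) := by
    intro a b ha hab
    have h := hmono (Real.log_nonneg ha) (Real.log_nonneg (ha.trans hab))
      (Real.log_le_log (by linarith) hab)
    simp only [Real.exp_log (by linarith : 0 < a), Real.exp_log (by linarith : 0 < b)] at h
    linarith
  have hsq : ∀ {a b : ℝ}, 1 ≤ a → a ≤ b → 0 ≤ Real.log b ^ 2 - Real.log a ^ 2 := by
    intro a b ha hab
    have h1 := Real.log_nonneg ha
    have h2 := Real.log_le_log (by linarith) hab
    nlinarith
  rcases le_total a b with h | h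
  · rw [abs_sub_comm, abs_of_nonneg (hsq ha h), abs_sub_comm]
    exact (key ha h).trans (mul_le_mul_of_nonneg_left (le_abs_self _) (by norm_num))
  · rw [abs_of_nonneg (hsq hb h)]
    exact (key hb h).trans (mul_le_mul_of_nonneg_left (le_abs_self _) (by norm_num))

end RiemannSum

/-! ### The water level and the capacity as finite sums -/

section WaterFilling

/-- Intermediate values: the sum is 0 at a = 1, and at a = e^d + s the term k = 0 alone is s. -/
lemma exists_waterLevel {d s : ℝ} (hd : 0 < d) (hs : 0 ≤ s) :
    ∃ (a : ℝ) (K : ℕ), 1 ≤ a ∧ Real.log a ≤ d * (2 * K - 1) ∧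
      s = ∑ k ∈ Finset.range K, max 0 (a - Real.exp (d * (2 * k + 1))) := by
  have he : 1 ≤ Real.exp d := Real.one_le_exp hd.le
  -- K is fixed beforehand, so large that no subchannel from index K on is active even at the
  -- highest level e^d + s.
  obtain ⟨K, hK⟩ := exists_nat_ge (Real.log (Real.exp d + s) / d + 1)
  have hlog : Real.log (Real.exp d + s) ≤ d * (K - 1) := by
    rw [mul_comm, ← div_le_iff₀ hd]; linarith
  have hdl : d ≤ Real.log (Real.exp d + s) := by
    rw [Real.le_log_iff_exp_le (by linarith)]; linarith
  have hK1 : (1 : ℝ) < K := by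
    by_contra hle
    nlinarith
  have hK0 : 0 ∈ Finset.range K := by
    rw [Finset.mem_range]
    exact_mod_cast zero_lt_one.trans hK1
  have hcont : Continuous fun a : ℝ =>
      ∑ k ∈ Finset.range K, max 0 (a - Real.exp (d * (2 * k + 1))) := by fun_prop
  have hmem : s ∈ Set.Icc (∑ k ∈ Finset.range K, max 0 ((1 : ℝ) - Real.exp (d * (2 * k + 1))))
      (∑ k ∈ Finset.range K, max 0 (Real.exp d + s - Real.exp (d * (2 * k + 1)))) := by
    constructor
    · rw [Finset.sum_eq_zero fun k _ => ?_]
      · exact hs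
      · exact max_eq_left (sub_nonpos.2 (Real.one_le_exp (by positivity)))
    · refine le_trans ?_ (Finset.single_le_sum (fun k _ => le_max_left _ _) hK0)
      simp
  obtain ⟨a, ha, has⟩ := intermediate_value_Icc (by linarith : 1 ≤ Real.exp d + s)
    hcont.continuousOn hmem
  refine ⟨a, K, ha.1, ?_, has.symm⟩
  have := Real.log_le_log (by linarith [ha.1]) ha.2
  nlinarith

variable {Ω : Type*} [MeasurableSpace Ω] {P : Measure Ω} [IsProbabilityMeasure P]
  {n : Signal → Ω → ℝ} {θ α β : ℝ}

lemma coe_subchannelVar_eq_exp (θ α β : ℝ) (k : ℕ) :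
    (subchannelVar θ α β k : ℝ) = θ ^ 2 * Real.exp (delta α β * (2 * k + 1)) := by
  rw [coe_subchannelVar, mul_pow, Real.sq_sqrt (rho_pos α β).le, rho, ← Real.exp_nat_mul,
    ← Real.exp_nat_mul, ← Real.exp_add, div_eq_mul_inv, ← Real.exp_neg]
  congr 2
  push_cast
  ring

lemma exists_capacity_eq (hθ : 0 < θ) (hn : IsWhiteNoise P n (θ ^ 2)) (hα : 0 < α) (hβ : 0 < β)
    (h : 1 < α * β) {S : ℝ} (hS : 0 ≤ S) :
    ∃ (a : ℝ) (K : ℕ), 1 ≤ a ∧ Real.log a ≤ delta α β * (2 * K - 1) ∧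
      S = θ ^ 2 * ∑ k ∈ Finset.range K, max 0 (a - Real.exp (delta α β * (2 * k + 1))) ∧
      capacity P n α β S = ENNReal.ofReal
        (1 / 2 * ∑ k ∈ Finset.range K, max 0 (Real.log a - delta α β * (2 * k + 1))) := by
  obtain ⟨a, K, ha, hK, hs⟩ := exists_waterLevel (delta_spec h).1
    (by positivity : 0 ≤ S / θ ^ 2)
  have hd := (delta_spec h).1
  have ha0 : 0 < a := by linarith
  have hw : ((θ ^ 2 * a).toNNReal : ℝ) = θ ^ 2 * a := Real.coe_toNNReal _ (by positivity)
  have hv := coe_subchannelVar_eq_exp θ α β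
  have hSs : S = θ ^ 2 * ∑ k ∈ Finset.range K, max 0 (a - Real.exp (delta α β * (2 * k + 1))) := by
    rw [← hs]; field_simp
  refine ⟨a, K, ha, hK, hSs, ?_⟩
  have hv0 : ∀ k, subchannelVar θ α β k ≠ 0 := fun k => by
    rw [← NNReal.coe_ne_zero, hv]
    positivity
  have hw0 : (θ ^ 2 * a).toNNReal ≠ 0 := by
    rw [← NNReal.coe_ne_zero, hw]
    positivity
  have hwv : ∀ k, K ≤ k → (θ ^ 2 * a).toNNReal ≤ subchannelVar θ α β k := fun k hk => by
    rw [← NNReal.coe_le_coe, hw, hv]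
    gcongr
    rw [← Real.log_le_iff_le_exp ha0]
    refine hK.trans (mul_le_mul_of_nonneg_left ?_ hd.le)
    have : (K : ℝ) ≤ k := by exact_mod_cast hk
    linarith
  rw [capacity_eq_parallelCapacity hn hα hβ h,
    parallelCapacity_eq (subchannelVar θ α β) hv0 hw0 hwv (S := S)]
  · rw [Finset.mul_sum]
    congr 1
    refine Finset.sum_congr rfl fun k _ => ?_
    rw [NNReal.coe_max, hw, hv, ← mul_max_of_nonneg _ _ (by positivity),
      mul_div_mul_left _ _ (by positivity)]
    congr 1
    rcases le_total a (Real.exp (delta α β * (2 * k + 1))) with hle | hle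
    · rw [max_eq_right hle, div_self (Real.exp_pos _).ne', Real.log_one, max_eq_left]
      exact sub_nonpos.2 ((Real.log_le_iff_le_exp ha0).2 hle)
    · rw [max_eq_left hle, Real.log_div ha0.ne' (Real.exp_pos _).ne', Real.log_exp, max_eq_right]
      exact sub_nonneg.2 ((Real.le_log_iff_exp_le ha0).2 hle)
  · rw [hSs, Finset.mul_sum]
    refine Finset.sum_congr rfl fun k _ => ?_
    rw [NNReal.coe_sub_def, hw, hv, ← mul_sub, max_comm, mul_max_of_nonneg _ _ (by positivity),
      mul_zero]

lemma delta_eq_delta_mul_one (α β : ℝ) : delta α β = delta (α * β) 1 := by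
  rw [delta, delta, mul_one]

/-- The subchannel variances see α and β only through δ; this permits working on the curve (x, 1).
-/
lemma capacity_eq_capacity_mul_one (hn : IsWhiteNoise P n (θ ^ 2)) (hα : 0 < α) (hβ : 0 < β)
    (h : 1 < α * β) (S : ℝ) : capacity P n α β S = capacity P n (α * β) 1 S := by
  rw [capacity_eq_parallelCapacity hn hα hβ h,
    capacity_eq_parallelCapacity hn (by positivity) one_pos (by rwa [mul_one])]
  congr 1
  ext k
  rw [coe_subchannelVar_eq_exp, coe_subchannelVar_eq_exp, delta_eq_delta_mul_one]

end WaterFilling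

/-! ### Limits as αβ → ∞ -/

section Asymptotics

/-- The filter defining `Doteq` is pulled back along the product, and the curve x ↦ (x, 1) tends to
it. -/
lemma doteq_iff {A B : ℝ → ℝ → ℝ} {D : ℝ → ℝ}
    (h : ∀ α β, 0 < α → 0 < β → 1 < α * β → A α β - B α β = D (α * β)) :
    Doteq A B ↔ Tendsto (fun x => D x / x) atTop (𝓝 0) := by
  constructor
  · intro hd
    have hcurve : Tendsto (fun x : ℝ => (x, (1 : ℝ))) atTop
        (comap (fun p : ℝ × ℝ => p.1 * p.2) atTop ⊓ 𝓟 {p | 0 < p.1 ∧ 0 < p.2}) := by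
      refine tendsto_inf.2 ⟨tendsto_comap_iff.2 ?_, tendsto_principal.2 ?_⟩
      · simpa only [Function.comp_def, mul_one] using! tendsto_id
      · filter_upwards [eventually_gt_atTop 0] with x hx using ⟨hx, one_pos⟩
    refine (hd.comp hcurve).congr' ?_
    filter_upwards [eventually_gt_atTop 1] with x hx
    have := h x 1 (by linarith) one_pos (by linarith)
    simp only [Function.comp_apply, this, mul_one]
  · intro hd
    have hp : Tendsto (fun p : ℝ × ℝ => p.1 * p.2)
        (comap (fun p : ℝ × ℝ => p.1 * p.2) atTop ⊓ 𝓟 {p | 0 < p.1 ∧ 0 < p.2}) atTop :=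
      tendsto_comap.mono_left inf_le_left
    refine (hd.comp hp).congr' ?_
    filter_upwards [hp.eventually_gt_atTop 1,
      mem_inf_of_right (mem_principal_self {p : ℝ × ℝ | 0 < p.1 ∧ 0 < p.2})] with p h1 h2
    simp only [Function.comp_apply, h p.1 p.2 h2.1 h2.2 h1]

lemma sinh_le_mul_cosh {d : ℝ} (hd : 0 ≤ d) : Real.sinh d ≤ d * Real.cosh d := by
  have hder : ∀ x : ℝ, HasDerivAt (fun x => x * Real.cosh x - Real.sinh x) (x * Real.sinh x) x :=
    fun x => by
      refine (((hasDerivAt_id x).mul (Real.hasDerivAt_cosh x)).sub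
        (Real.hasDerivAt_sinh x)).congr_deriv ?_
      simp
  have hmono : MonotoneOn (fun x => x * Real.cosh x - Real.sinh x) (Set.Ici 0) := by
    refine monotoneOn_of_deriv_nonneg (convex_Ici 0) (by fun_prop)
      (fun x _ => (hder x).differentiableAt.differentiableWithinAt) fun x hx => ?_
    rw [(hder x).deriv]
    rw [interior_Ici] at hx
    have hx' : 0 ≤ x := le_of_lt hx
    exact mul_nonneg hx' (Real.sinh_nonneg_iff.2 hx')
  have := hmono Set.self_mem_Ici hd hd
  simp only [zero_mul, Real.sinh_zero, sub_zero] at this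
  linarith

lemma tendsto_sqrt_one_sub_inv_sq : Tendsto (fun x : ℝ => √(1 - (1 / x) ^ 2)) atTop (𝓝 1) := by
  have h1 : Tendsto (fun x : ℝ => 1 / x) atTop (𝓝 0) := by
    simpa only [one_div] using tendsto_inv_atTop_zero
  simpa using ((tendsto_const_nhds (x := (1 : ℝ))).sub (h1.pow 2)).sqrt

lemma eventually_one_div_mem : ∀ᶠ x : ℝ in atTop, 1 / x ∈ Set.Ioo (-1 : ℝ) 1 := by
  filter_upwards [eventually_gt_atTop 1] with x hx
  have : 0 < 1 / x := by positivity
  exact ⟨by linarith, (div_lt_one (by linarith)).2 hx⟩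

lemma tendsto_cosh_delta : Tendsto (fun x => Real.cosh (delta x 1)) atTop (𝓝 1) := by
  have h := tendsto_const_nhds (x := (1 : ℝ)).div tendsto_sqrt_one_sub_inv_sq one_ne_zero
  rw [div_one] at h
  refine h.congr' ?_
  filter_upwards [eventually_one_div_mem] with x hx
  rw [delta, mul_one, Real.cosh_artanh hx, Pi.div_apply]

/-- From x = coth δ and tanh δ ≤ δ ≤ sinh δ one gets 1 ≤ xδ ≤ cosh δ. -/
lemma tendsto_mul_delta : Tendsto (fun x => x * delta x 1) atTop (𝓝 1) := by
  refine tendsto_of_tendsto_of_tendsto_of_le_of_le' tendsto_const_nhds tendsto_cosh_delta ?_ ?_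
  all_goals
    filter_upwards [eventually_gt_atTop 1] with x hx
    have hx' : 1 < x * 1 := by rwa [mul_one]
    have hd := (delta_spec hx').1
    have hms := mul_sinh_delta hx'
    have hc := Real.cosh_pos (delta x 1)
    rw [mul_one] at hms
  · have := sinh_le_mul_cosh hd.le
    by_contra! hlt
    nlinarith
  · rw [← hms]
    have := Real.self_le_sinh_iff.2 hd.le
    gcongr

lemma tendsto_delta : Tendsto (fun x => delta x 1) atTop (𝓝 0) := by
  have h := tendsto_mul_delta.mul tendsto_inv_atTop_zero
  rw [mul_zero] at h
  refine h.congr' ?_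
  filter_upwards [eventually_gt_atTop 0] with x hx
  field_simp

lemma entropy_nonneg {a : ℝ} (ha : 1 ≤ a) : 0 ≤ a * Real.log a - a + 1 := by
  have h0 : 0 < a := by linarith
  have := Real.one_sub_inv_le_log_of_pos h0
  have := mul_le_mul_of_nonneg_left this h0.le
  rw [mul_sub, mul_inv_cancel₀ h0.ne'] at this
  linarith

lemma le_entropy_add {a : ℝ} (ha : 1 ≤ a) : a ≤ (a * Real.log a - a + 1) + Real.exp 2 := by
  have h0 : 0 < a := by linarith
  rcases le_total a (Real.exp 2) with h | h
  · linarith [entropy_nonneg ha]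
  · have := (Real.le_log_iff_exp_le h0).2 h
    nlinarith [Real.exp_pos 2]

lemma exists_entropy_eq {s : ℝ} (hs : 0 ≤ s) : ∃ b, 1 ≤ b ∧ b * Real.log b - b + 1 = s := by
  have hexp : 1 ≤ Real.exp (s + 2) := Real.one_le_exp (by linarith)
  have hcont : ContinuousOn (fun b : ℝ => b * Real.log b - b + 1)
      (Set.Icc 1 (Real.exp (s + 2))) := by
    refine ((continuousOn_id.mul (Real.continuousOn_log.mono fun b hb => ?_)).sub
      continuousOn_id).add continuousOn_const
    have : (1 : ℝ) ≤ b := hb.1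
    exact (by linarith : b ≠ 0)
  obtain ⟨b, hb, hbs⟩ := intermediate_value_Icc hexp hcont (show s ∈ Set.Icc _ _ from by
    refine ⟨by simpa using hs, ?_⟩
    simp only [Real.log_exp]
    nlinarith)
  exact ⟨b, hb.1, hbs⟩

/-- The comparison of the Riemann sums for energy and capacity with their integrals: if the
energies agree asymptotically, then so do the capacities. -/
lemma capacity_isLittleO_of_energy_isLittleO {ι : Type*} {l : Filter ι}
    {y ch d a b s₁ s₂ : ι → ℝ} (hy : Tendsto y l (𝓝 1)) (hch : Tendsto ch l (𝓝 1))
    (hd : Tendsto d l (𝓝 0)) (hd0 : ∀ᶠ x in l, 0 < d x) (ha : ∀ᶠ x in l, 1 ≤ a x)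
    (hb : ∀ x, 1 ≤ b x) (hs₁ : s₁ =O[l] fun _ => (1 : ℝ))
    (h₁ : ∀ᶠ x in l, |s₁ x - (a x * Real.log (a x) - a x + 1)| ≤ d x * a x)
    (h₂ : ∀ᶠ x in l, |s₂ x - Real.log (a x) ^ 2 / 2| ≤ d x * (Real.log (a x) + d x))
    (h : Tendsto (fun x => s₁ x / y x - ch x * (b x * Real.log (b x) - b x + 1)) l (𝓝 0)) :
    Tendsto (fun x => s₂ x / y x - Real.log (b x) ^ 2 / 2) l (𝓝 0) := by
  have hd1 : d =o[l] fun _ => (1 : ℝ) := (isLittleO_one_iff ℝ).2 hd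
  have hy0 : ∀ᶠ x in l, y x ≠ 0 := hy.eventually_ne one_ne_zero
  have hch0 : ∀ᶠ x in l, ch x ≠ 0 := hch.eventually_ne one_ne_zero
  -- The water level stays bounded: `le_entropy_add` and `h₁` give a ≤ s₁ + d·a + e², and d·a is
  -- absorbed once d ≤ 1/2.
  have haO : a =O[l] fun _ => (1 : ℝ) := by
    refine IsBigO.trans (g := fun x => s₁ x + Real.exp 2) ?_
      (hs₁.add (isBigO_const_const _ one_ne_zero l))
    refine IsBigO.of_bound 2 ?_
    filter_upwards [ha, h₁, hd0, hd.eventually_le_const (by norm_num : (0 : ℝ) < 1 / 2)]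
      with x hx h1 hx0 hx2
    have h3 := le_entropy_add hx
    have h4 := (abs_le.1 h1).1
    rw [Real.norm_eq_abs, Real.norm_eq_abs, abs_of_nonneg (by linarith)]
    have h5 : a x ≤ 2 * (s₁ x + Real.exp 2) := by nlinarith
    exact h5.trans (mul_le_mul_of_nonneg_left (le_abs_self _) (by norm_num))
  have hLO : (fun x => Real.log (a x)) =O[l] fun _ => (1 : ℝ) := by
    refine IsBigO.trans (IsBigO.of_bound 1 ?_) haO
    filter_upwards [ha] with x hx
    rw [one_mul, Real.norm_eq_abs, Real.norm_eq_abs, abs_of_nonneg (Real.log_nonneg hx),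
      abs_of_nonneg (by linarith)]
    linarith [Real.log_le_sub_one_of_pos (by linarith : 0 < a x)]
  have e₁ : (fun x => s₁ x - (a x * Real.log (a x) - a x + 1)) =o[l] fun _ => (1 : ℝ) := by
    refine IsBigO.trans_isLittleO (g := fun x => d x * a x) (IsBigO.of_bound 1 ?_)
      (by simpa using hd1.mul_isBigO haO)
    filter_upwards [h₁] with x hx
    rw [one_mul, Real.norm_eq_abs, Real.norm_eq_abs]
    exact hx.trans (le_abs_self _)
  have e₂ : (fun x => s₂ x - Real.log (a x) ^ 2 / 2) =o[l] fun _ => (1 : ℝ) := by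
    refine IsBigO.trans_isLittleO (g := fun x => d x * (Real.log (a x) + d x))
      (IsBigO.of_bound 1 ?_) (by simpa using hd1.mul_isBigO (hLO.add hd1.isBigO))
    filter_upwards [h₂] with x hx
    rw [one_mul, Real.norm_eq_abs, Real.norm_eq_abs]
    exact hx.trans (le_abs_self _)
  have hs₂ : s₂ =O[l] fun _ => (1 : ℝ) := by
    have hsq : (fun x => Real.log (a x) ^ 2 / 2) =O[l] fun _ => (1 : ℝ) := by
      simpa [div_eq_inv_mul] using (hLO.pow 2).const_mul_left (2 : ℝ)⁻¹
    simpa using e₂.isBigO.add hsq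
  have hchy : Tendsto (fun x => 1 / (y x * ch x) - 1) l (𝓝 0) := by
    simpa using ((tendsto_const_nhds (x := (1 : ℝ))).div (hy.mul hch) (by simp)).sub_const 1
  have hyi : Tendsto (fun x => 1 / y x - 1) l (𝓝 0) := by
    simpa using ((tendsto_const_nhds (x := (1 : ℝ))).div hy one_ne_zero).sub_const 1
  have hchi : Tendsto (fun x => 1 / ch x) l (𝓝 1) := by
    simpa only [div_one] using! (tendsto_const_nhds (x := (1 : ℝ))).div hch one_ne_zero
  -- As y and ch tend to 1 and s₁ is bounded, both factors can be dropped from the energy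
  -- hypothesis.
  have e₃ : (fun x => s₁ x - (b x * Real.log (b x) - b x + 1)) =o[l] fun _ => (1 : ℝ) := by
    have t₁ : (fun x => s₁ x * (1 / (y x * ch x) - 1)) =o[l] fun _ => (1 : ℝ) := by
      simpa using hs₁.mul_isLittleO ((isLittleO_one_iff ℝ).2 hchy)
    have t₂ := (isLittleO_one_iff ℝ).2 (by simpa using h.mul hchi)
    refine (t₂.sub t₁).congr' ?_ EventuallyEq.rfl
    filter_upwards [hy0, hch0] with x hx hx'
    field_simp
    ring
  have e₄ : (fun x => Real.log (a x) ^ 2 - Real.log (b x) ^ 2) =o[l] fun _ => (1 : ℝ) := by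
    refine IsBigO.trans_isLittleO (IsBigO.of_bound 2 ?_) (e₃.sub e₁)
    filter_upwards [ha] with x hx
    rw [Real.norm_eq_abs, Real.norm_eq_abs]
    refine (sq_sub_sq_le_entropy hx (hb x)).trans_eq ?_
    congr 2
    ring
  have t₃ : (fun x => s₂ x * (1 / y x - 1)) =o[l] fun _ => (1 : ℝ) := by
    simpa using hs₂.mul_isLittleO ((isLittleO_one_iff ℝ).2 hyi)
  refine (isLittleO_one_iff ℝ).1 (((t₃.add e₂).add (e₄.const_mul_left (1 / 2))).congr_left ?_)
  intro x
  ring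

end Asymptotics

/-! ### The asymptotic formulas -/

section Doteq

variable {Ω : Type*} [MeasurableSpace Ω] {P : Measure Ω} [IsProbabilityMeasure P]
  {n : Signal → Ω → ℝ} {θ α β : ℝ} {S : ℝ → ℝ}

lemma noiseFloor_eq_mul_one (θ α β : ℝ) : noiseFloor θ α β = noiseFloor θ (α * β) 1 := by
  rw [noiseFloor, delta_eq_delta_mul_one, noiseFloor]

lemma energyIntegral_eq_mul_one (hθ : 0 < θ) (hα : 0 < α) (hβ : 0 < β) (ν : ℝ) :
    energyIntegral θ α β ν = energyIntegral θ (α * β) 1 ν := by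
  rw [energyIntegral_eq hθ hα hβ, energyIntegral_eq hθ (by positivity) one_pos,
    noiseFloor_eq_mul_one θ α β, mul_one]

lemma capacityIntegral_eq_mul_one (hθ : 0 < θ) (hα : 0 < α) (hβ : 0 < β) (ν : ℝ) :
    capacityIntegral θ α β ν = capacityIntegral θ (α * β) 1 ν := by
  rw [capacityIntegral_eq hθ hα hβ, capacityIntegral_eq hθ (by positivity) one_pos,
    noiseFloor_eq_mul_one θ α β, mul_one]

/-- The energy equation is solved exactly for αβ > 1, since b ln b - b + 1 maps [1, ∞) onto [0, ∞).
-/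
lemma exists_doteq_energyIntegral (hθ : 0 < θ) (hS : ∀ x, 1 < x → 0 ≤ S x) :
    ∃ ν : ℝ → ℝ, Doteq (fun α β => S (α * β))
      fun α β => energyIntegral θ α β (ν (α * β)) := by
  have key : ∀ x, 1 < x → ∃ ν, energyIntegral θ x 1 ν = S x := by
    intro x hx
    have hc := noiseFloor_pos hθ x 1
    have hx0 : 0 < x := by linarith
    have hπ := Real.pi_pos
    have hpos : 0 < Real.pi * (x * 1) * noiseFloor θ x 1 := by positivity
    obtain ⟨b, hb, hbs⟩ := exists_entropy_eq (div_nonneg (hS x hx) hpos.le)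
    refine ⟨noiseFloor θ x 1 * b, ?_⟩
    rw [energyIntegral_eq hθ hx0 one_pos, mul_div_cancel_left₀ _ hc.ne', max_eq_right hb, hbs,
      mul_div_cancel₀ _ hpos.ne']
  choose! ν hν using key
  refine ⟨ν, (doteq_iff (D := fun x => S x - energyIntegral θ x 1 (ν x))
    fun α β hα hβ _ => by rw [energyIntegral_eq_mul_one hθ hα hβ]).2 ?_⟩
  refine tendsto_const_nhds.congr' ?_
  filter_upwards [eventually_gt_atTop 1] with x hx
  rw [hν x hx, sub_self, zero_div]

lemma doteq_capacityIntegral (hθ : 0 < θ) (hn : IsWhiteNoise P n (θ ^ 2))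
    (hS : ∀ x, 1 < x → 0 ≤ S x) (hSO : S =O[atTop] fun x : ℝ => x) {ν : ℝ → ℝ}
    (hν : Doteq (fun α β => S (α * β)) fun α β => energyIntegral θ α β (ν (α * β))) :
    Doteq (fun α β => (capacity P n α β (S (α * β))).toReal)
      fun α β => capacityIntegral θ α β (ν (α * β)) := by
  rw [doteq_iff (D := fun x => S x - energyIntegral θ x 1 (ν x))
    fun α β hα hβ _ => by rw [energyIntegral_eq_mul_one hθ hα hβ]] at hν
  rw [doteq_iff (D := fun x => (capacity P n x 1 (S x)).toReal - capacityIntegral θ x 1 (ν x))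
    fun α β hα hβ h => by
      rw [capacityIntegral_eq_mul_one hθ hα hβ, capacity_eq_capacity_mul_one hn hα hβ h]]
  have key : ∀ x, 1 < x → ∃ (a : ℝ) (K : ℕ), 1 ≤ a ∧ Real.log a ≤ delta x 1 * (2 * K - 1) ∧
      S x = θ ^ 2 * ∑ k ∈ Finset.range K, max 0 (a - Real.exp (delta x 1 * (2 * k + 1))) ∧
      capacity P n x 1 (S x) = ENNReal.ofReal
        (1 / 2 * ∑ k ∈ Finset.range K, max 0 (Real.log a - delta x 1 * (2 * k + 1))) :=
    fun x hx => exists_capacity_eq hθ hn (by linarith) one_pos (by rwa [mul_one]) (hS x hx)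
  choose! a K ha hK hSa hCa using key
  set b : ℝ → ℝ := fun x => max 1 (ν x / noiseFloor θ x 1) with hb
  set s₁ : ℝ → ℝ := fun x =>
    2 * delta x 1 * ∑ k ∈ Finset.range (K x), max 0 (a x - Real.exp (delta x 1 * (2 * k + 1)))
    with hs₁
  set s₂ : ℝ → ℝ := fun x =>
    2 * delta x 1 * ∑ k ∈ Finset.range (K x), max 0 (Real.log (a x) - delta x 1 * (2 * k + 1))
    with hs₂
  have hgt : ∀ᶠ x : ℝ in atTop, 1 < x := eventually_gt_atTop 1
  have hd : ∀ x, 1 < x → 0 < delta x 1 := fun x hx => (delta_spec (by rwa [mul_one])).1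
  -- Here s₁ = 2δS/θ², which is bounded because S = O(x) and xδ → 1.
  have hs₁O : s₁ =O[atTop] fun _ => (1 : ℝ) := by
    have h1 : (fun x => 2 / θ ^ 2 * (delta x 1 * S x)) =O[atTop] fun _ => (1 : ℝ) := by
      refine IsBigO.const_mul_left ?_ _
      refine ((isBigO_refl (fun x => delta x 1) atTop).mul hSO).trans ?_
      simpa only [mul_comm] using tendsto_mul_delta.isBigO_one ℝ
    refine h1.congr' ?_ EventuallyEq.rfl
    filter_upwards [hgt] with x hx
    rw [hSa x hx, hs₁]
    field_simp
  have main := capacity_isLittleO_of_energy_isLittleO (s₁ := s₁) (s₂ := s₂) (a := a) (b := b)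
    tendsto_mul_delta tendsto_cosh_delta tendsto_delta (hgt.mono hd) (hgt.mono ha)
    (fun x => le_max_left _ _) hs₁O
    (hgt.mono fun x hx => abs_sum_max_sub_exp_le (ha x hx) (hd x hx) (hK x hx))
    (hgt.mono fun x hx => abs_sum_max_sub_le (Real.log_nonneg (ha x hx)) (hd x hx) (hK x hx))
    (by
      -- S/x = θ²s₁/(2xδ), and the energy integral over x is (θ²/2) cosh δ (b ln b - b + 1); the
      -- factor 2/θ² clears both constants.
      have h1 := hν.const_mul (2 / θ ^ 2)
      rw [mul_zero] at h1
      refine h1.congr' ?_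
      filter_upwards [hgt] with x hx
      have hx0 : x ≠ 0 := by linarith
      have hd0 := (hd x hx).ne'
      rw [energyIntegral_eq hθ (by linarith) one_pos, hSa x hx, hs₁,
        show max 1 (ν x / noiseFloor θ x 1) = b x from rfl, noiseFloor]
      have := Real.pi_ne_zero
      field_simp)
  -- C/x = s₂/(4xδ), and the capacity integral over x is (ln b)²/8.
  have h2 := main.const_mul (1 / 4)
  rw [mul_zero] at h2
  refine h2.congr' ?_
  filter_upwards [hgt] with x hx
  have hx0 : x ≠ 0 := by linarith
  have hd0 := (hd x hx).ne'
  rw [capacityIntegral_eq hθ (by linarith) one_pos, hCa x hx, ENNReal.toReal_ofReal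
    (mul_nonneg (by norm_num) (Finset.sum_nonneg fun k _ => le_max_left _ _)), hs₂, hb]
  field_simp
  ring

end Doteq

end HeatChannel

theorem theorem2 {Ω : Type*} [MeasurableSpace Ω] (P : Measure Ω) [IsProbabilityMeasure P]
    (θ : ℝ) (hθ : 0 < θ)
    (n : HeatChannel.Signal → Ω → ℝ) (hn : HeatChannel.IsWhiteNoise P n (θ ^ 2))
    (S : ℝ → ℝ) (hS_nonneg : ∀ x, 1 < x → 0 ≤ S x)
    (hS : S =O[atTop] fun x : ℝ => x) :
    (∀ α β : ℝ, 0 < α → 0 < β → 1 < α * β →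
      HeatChannel.capacity P n α β (S (α * β)) ≠ ∞ ∧
      HeatChannel.capacity P n α β (S (α * β)) =
        HeatChannel.parallelCapacity (HeatChannel.subchannelVar θ α β) (S (α * β))) ∧
    (∃ ν : ℝ → ℝ, HeatChannel.Doteq (fun α β => S (α * β))
      fun α β => HeatChannel.energyIntegral θ α β (ν (α * β))) ∧
    ∀ ν : ℝ → ℝ,
      HeatChannel.Doteq (fun α β => S (α * β))
        (fun α β => HeatChannel.energyIntegral θ α β (ν (α * β))) →
      HeatChannel.Doteq (fun α β => (HeatChannel.capacity P n α β (S (α * β))).toReal)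
        (fun α β => HeatChannel.capacityIntegral θ α β (ν (α * β))) := by
  refine ⟨fun α β hα hβ h => ⟨?_, ?_⟩, HeatChannel.exists_doteq_energyIntegral hθ hS_nonneg,
    fun ν hν => HeatChannel.doteq_capacityIntegral hθ hn hS_nonneg hS hν⟩
  · obtain ⟨a, K, -, -, -, hC⟩ :=
      HeatChannel.exists_capacity_eq hθ hn hα hβ h (hS_nonneg _ h)
    rw [hC]
    exact ENNReal.ofReal_ne_top
  · exact HeatChannel.capacity_eq_parallelCapacity hn hα hβ h _
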